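/- Notation. Let $N\ge 1$. Partitions $\lambda,\mu$ have length $\le N$; $\lambda'$ is the conjugate of $\lambda$, $(a^b)$ is the partition with $b$ parts equal to $a$, and partitions are added part by part. $s_{\kappa/\lambda}$ is the skew Schur polynomial (the generating function of semistandard tableaux of shape $\kappa/\lambda$, equal to $0$ if $\lambda\not\subseteq\kappa$), $s_\lambda=s_{\lambda/\varnothing}$, $(\kappa/\lambda)'=\kappa'/\lambda'$, $s(1^n)$ is the value of the $n$-variable polynomial $s$ at $(1,\dots,1)$, and $e_k$ is the $k$-th elementary symmetric polynomial. For a function $f$ on the unit circle with Fourier coefficients $d_n=\frac1{2\pi}\int_{-\pi}^{\pi}f(e^{i\theta})e^{-in\theta}\,d\theta$ put $$D_N^{\lambda,\mu}(f)=\det\left(d_{j-\lambda_j-k+\mu_k}\right)_{j,k=1}^N .$$ For positive integers $\gamma,\delta$ let $\varphi_{\gamma,\delta}(z)=(1+z)^\gamma(1+z^{-1})^\delta$. For real $\gamma,\delta>0$ and polynomials $P,Q$ in $N$ variables let $$I_N^{\gamma,\delta}(P,Q)=\frac1{N!\,(2\pi)^N}\int_{(-\pi,\pi)^N}P(e^{i\theta_1},\dots,e^{i\theta_N})\,Q(e^{-i\theta_1},\dots,e^{-i\theta_N})\prod_{j=1}^N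 e^{\frac12 i\theta_j(\gamma-\delta)}|1+e^{i\theta_j}|^{\gamma+\delta}\prod_{1\le j<k\le N}|e^{i\theta_j}-e^{i\theta_k}|^2\,d\theta_1\cdots d\theta_N$$ (the Morris integral with insertions $P,Q$). For integers $0\le j,k\le N$ and real $M,d$ let $$R_{N}^{j,k}(M,d)=G(N+2)\frac{G(M+N+2)}{G(M+1)}\frac{G(M-d+1)}{G(M-d+N+2)}\frac{G(d+1)}{G(d+N+2)}\,\frac{\Gamma(M-d+j+1)}{\Gamma(j+1)}\frac{\Gamma(d+k+1)}{\Gamma(k+1)}\sum_{r=\max(j,k)}^{N}\frac{\Gamma(r+1)}{\Gamma(M+r+1)}\binom{M-d+r-k-1}{r-k}\binom{d+r-j-1}{r-j},$$ where $G$ is the Barnes $G$-function and $\binom{x}{n}=x(x-1)\cdots(x-n+1)/n!$. Theorem. Let $N\ge1$. (1) For all positive integers $\gamma,\delta$ and all partitions $\lambda,\mu$ of length at most $N$, $$I_N^{\gamma,\delta}(s_\lambda,s_\mu)=D_N^{\lambda,\mu}(\varphi_{\gamma,\delta})=s_{((\delta^N)+\mu/\lambda)'}(1^{\gamma+\delta}).$$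 (2) For $0\le k\le N$, $s_{(1^k)}=e_k$ in $N$ variables. (3) For all integers $0\le j,k\le N$ and $0\le d\le M$ such that $M>d$ or $j=0$, $$s_{(\underbrace{N,\dots,N}_{d},\,j)/(k)}(1^M)=R_N^{j,k}(M,d).$$ (4) For all integers $0\le j,k\le N$ and all real $\gamma,\delta>0$, $$I_N^{\gamma,\delta}(e_k,e_j)=R_N^{j,k}(\gamma+\delta,\delta),$$ that is, the Morris integral with $s_\lambda=e_k$, $s_\mu=e_j$ has the explicit value obtained from (3) by replacing $M-d$ by $\gamma$ and $d$ by $\delta$. -/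

import Mathlib

open scoped Real

noncomputable section

/-! ### Partitions

Partitions are Young diagrams: `mu.rowLen i` is the part `μ_{i+1}`, `mu.colLen 0` is the length
`l(μ)`, and `mu.transpose` is the conjugate partition. -/

/-- The partition `(a^b)` with `b` parts equal to `a`. -/
def rectPartition (a b : ℕ) : YoungDiagram where
  cells := Finset.range b ×ˢ Finset.range a
  isLowerSet := by
    rintro ⟨i, j⟩ ⟨i', j'⟩ ⟨h1, h2⟩ h
    simp only [Finset.coe_product, Finset.coe_range, Set.mem_prod, Set.mem_Iio] at h ⊢
    exact ⟨lt_of_le_of_lt h1 h.1, lt_of_le_of_lt h2 h.2⟩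

theorem mem_rectPartition {a b i j : ℕ} : (i, j) ∈ rectPartition a b ↔ i < b ∧ j < a := by
  rw [← YoungDiagram.mem_cells]
  simp [rectPartition]

/-- The partwise sum `α + β` of two partitions, with parts `α_i + β_i`. -/
def addPartition (α β : YoungDiagram) : YoungDiagram where
  cells := (Finset.range (max (α.colLen 0) (β.colLen 0)) ×ˢ
    Finset.range (α.rowLen 0 + β.rowLen 0)).filter fun c => c.2 < α.rowLen c.1 + β.rowLen c.1
  isLowerSet := by
    rintro ⟨i, j⟩ ⟨i', j'⟩ ⟨h1, h2⟩ h
    simp only [Finset.coe_filter, Finset.mem_product, Finset.mem_range, Set.mem_ofPred_eq] at h ⊢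
    simp only at h1 h2
    have ha := α.rowLen_anti i' i h1
    have hb := β.rowLen_anti i' i h1
    omega

theorem mem_addPartition {α β : YoungDiagram} {i j : ℕ} :
    (i, j) ∈ addPartition α β ↔ j < α.rowLen i + β.rowLen i := by
  rw [← YoungDiagram.mem_cells]
  simp only [addPartition, Finset.mem_filter, Finset.mem_product, Finset.mem_range]
  refine ⟨fun h => h.2, fun h => ⟨⟨?_, ?_⟩, h⟩⟩
  · rw [lt_max_iff, ← YoungDiagram.mem_iff_lt_colLen, ← YoungDiagram.mem_iff_lt_colLen,
      YoungDiagram.mem_iff_lt_rowLen, YoungDiagram.mem_iff_lt_rowLen]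
    omega
  · have ha := α.rowLen_anti 0 i (Nat.zero_le i)
    have hb := β.rowLen_anti 0 i (Nat.zero_le i)
    omega

theorem rowLen_addPartition (α β : YoungDiagram) (i : ℕ) :
    (addPartition α β).rowLen i = α.rowLen i + β.rowLen i :=
  eq_of_forall_lt_iff fun j => by
    rw [← YoungDiagram.mem_iff_lt_rowLen, mem_addPartition]

/-- The partition `(N, …, N, j)` with `d` parts `N` followed by one part `j ≤ N`. -/
def rectWithRow (N d j : ℕ) (h : j ≤ N) : YoungDiagram :=
  YoungDiagram.ofRowLens (List.replicate d N ++ [j]) (by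
    rw [List.sortedGE_iff_pairwise, List.pairwise_append]
    refine ⟨List.pairwise_replicate.2 (Or.inr le_rfl), List.pairwise_singleton _ _, ?_⟩
    intro a ha b hb
    rw [List.eq_of_mem_replicate ha, List.mem_singleton.1 hb]
    exact h)

/-! ### Schur and skew Schur polynomials -/

/-- The semistandard fillings of the skew diagram `ka / la` with entries in `{0, …, n - 1}`: weakly
increasing along rows and strictly increasing down columns. A cell `(a, b)` lies in row `a` and
column `b`. -/
def skewTableaux (ka la : YoungDiagram) (n : ℕ) :
    Set ({c : ℕ × ℕ // c ∈ ka.cells \ la.cells} → Fin n) :=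
  {T | (∀ c c', c.1.1 = c'.1.1 → c.1.2 < c'.1.2 → T c ≤ T c') ∧
    (∀ c c', c.1.2 = c'.1.2 → c.1.1 < c'.1.1 → T c < T c')}

open scoped Classical in
/-- The skew Schur polynomial `s_{ka/la}(x_1, …, x_n)`, the generating function of semistandard
tableaux of shape `ka / la`; it is zero if `la` is not contained in `ka`. -/
def skewSchur (R : Type*) [CommRing R] (ka la : YoungDiagram) (n : ℕ) : MvPolynomial (Fin n) R :=
  if la ≤ ka then
    ∑ T : {c : ℕ × ℕ // c ∈ ka.cells \ la.cells} → Fin n with T ∈ skewTableaux ka la n,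
      ∏ c, MvPolynomial.X (T c)
  else 0

/-- The Schur polynomial `s_la(x_1, …, x_n)`. -/
def schur (R : Type*) [CommRing R] (la : YoungDiagram) (n : ℕ) : MvPolynomial (Fin n) R :=
  skewSchur R la ⊥ n

/-- The value of a polynomial at `(1, …, 1)`. -/
def evalOnes {R : Type*} [CommRing R] {n : ℕ} (P : MvPolynomial (Fin n) R) : R :=
  MvPolynomial.eval (fun _ => 1) P

/-! ### Toeplitz minors -/

/-- The Fourier coefficient `d_n = (2π)⁻¹ ∫ f(e^{iθ}) e^{-inθ} dθ` of a function on the unit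
circle. -/
def circleCoeff (f : Circle → ℂ) (n : ℤ) : ℂ :=
  fourierCoeff (fun t : UnitAddCircle => f (AddCircle.toCircle t)) n

/-- The Toeplitz minor `D_N^{λ,μ}(f) = det (d_{j - λ_j - k + μ_k})_{j,k=1}^N`. -/
def toeplitzMinor (N : ℕ) (la mu : YoungDiagram) (f : Circle → ℂ) : ℂ :=
  Matrix.det (Matrix.of fun j k : Fin N =>
    circleCoeff f ((j : ℤ) - la.rowLen j - (k : ℤ) + mu.rowLen k))

/-- The pure Fisher–Hartwig symbol `φ_{γ,δ}(z) = (1 + z)^γ (1 + z⁻¹)^δ`, for integers `γ, δ`. -/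
def pureFH (γ δ : ℕ) (z : Circle) : ℂ :=
  (1 + (z : ℂ)) ^ γ * (1 + (z : ℂ)⁻¹) ^ δ

/-! ### The Morris integral -/

/-- The Morris integral over `(-π, π)^N` with weight `e^{iθ(γ-δ)/2} |1 + e^{iθ}|^{γ+δ}` and with
the polynomials `P(e^{iθ_1}, …, e^{iθ_N})` and `Q(e^{-iθ_1}, …, e^{-iθ_N})` inserted. -/
def morrisIntegral (N : ℕ) (γ δ : ℝ) (P Q : MvPolynomial (Fin N) ℂ) : ℂ :=
  1 / (N.factorial : ℂ) * (1 / (2 * (π : ℂ)) ^ N) *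
    ∫ θ in Set.univ.pi (fun _ : Fin N => Set.Ioo (-π) π),
      MvPolynomial.eval (fun j => Complex.exp ((θ j : ℂ) * Complex.I)) P *
      MvPolynomial.eval (fun j => Complex.exp (-(θ j : ℂ) * Complex.I)) Q *
      (∏ j, Complex.exp ((θ j : ℂ) * Complex.I * ((γ - δ : ℝ) : ℂ) / 2) *
        ((‖1 + Complex.exp ((θ j : ℂ) * Complex.I)‖ ^ (γ + δ) : ℝ) : ℂ)) *
      ∏ j, ∏ k ∈ Finset.Ioi j,
        ((‖Complex.exp ((θ j : ℂ) * Complex.I) - Complex.exp ((θ k : ℂ) * Complex.I)‖ ^ 2 : ℝ) : ℂ)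

/-! ### The explicit evaluation -/

/-- The Barnes function at a real argument, by its Weierstrass product
`G(1 + z) = (2π)^{z/2} e^{-(z + z²(1 + c))/2} ∏_{n ≥ 1} (1 + z/n)^n e^{z²/(2n) - z}`,
where `c` is the Euler–Mascheroni constant. -/
def barnesG (x : ℝ) : ℝ :=
  (2 * π) ^ ((x - 1) / 2) *
    Real.exp (-((x - 1) + (x - 1) ^ 2 * (1 + Real.eulerMascheroniConstant)) / 2) *
    ∏' n : ℕ, ((1 + (x - 1) / (n + 1)) ^ (n + 1) *
      Real.exp ((x - 1) ^ 2 / (2 * (n + 1)) - (x - 1)))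

/-- The explicit value
`G(N+2) G(M+N+2)/G(M+1) · G(M-d+1)/G(M-d+N+2) · G(d+1)/G(d+N+2)
  · Γ(M-d+j+1)/Γ(j+1) · Γ(d+k+1)/Γ(k+1)
  · ∑_{r=max(j,k)}^N Γ(r+1)/Γ(M+r+1) · binom(M-d+r-k-1, r-k) · binom(d+r-j-1, r-j)`;
here `Ring.choose x n = x (x-1) ⋯ (x-n+1) / n!`. -/
def explicitValue (N j k : ℕ) (M d : ℝ) : ℝ :=
  barnesG (N + 2) * (barnesG (M + N + 2) / barnesG (M + 1)) *
    (barnesG (M - d + 1) / barnesG (M - d + N + 2)) * (barnesG (d + 1) / barnesG (d + N + 2)) *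
    (Real.Gamma (M - d + j + 1) / Real.Gamma (j + 1)) *
    (Real.Gamma (d + k + 1) / Real.Gamma (k + 1)) *
    ∑ r ∈ Finset.Icc (max j k) N, Real.Gamma (r + 1) / Real.Gamma (M + r + 1) *
      Ring.choose (M - d + r - k - 1) (r - k) * Ring.choose (d + r - j - 1) (r - j)

end

/-! The entries of the Toeplitz minor are the Fourier coefficients of `(1 + z)^γ (1 + z⁻¹)^δ`, that
is, binomial coefficients, and these are the elementary symmetric polynomials at `(1, …, 1)`. So the
minor is a dual Jacobi–Trudi determinant. The dual Jacobi–Trudi identity follows by induction on the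
number of variables: removing the largest letter of a tableau removes a horizontal strip, and
multilinearity expands the determinant in the same way, with all superfluous terms vanishing because
of an equal pair of rows or a zero row.

The same induction gives the bialternant formula. It turns the integrand of the Morris integral into
a product of two determinants, and the Andréief identity integrates this product to a determinant of
Fourier coefficients. For real parameters these are quotients of Gamma functions: both sides satisfy
the same recurrence when `γ` and `δ` are raised by one, and their growth is compared by Laplace's
method.

If both partitions are columns, the minor omits one row and one column of the Toeplitz matrix of
size `N + 1`. Up to diagonal matrices of Gamma quotients, this matrix factors, by the
Chu–Vandermonde identity, into the triangular Toeplitz matrices of `(1 + z)^γ` and `(1 + z⁻¹)^δ`.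
The factors have explicit inverses, so the minor is the determinant times an entry of the inverse.
The functional equation `G (x + 1) = Γ x * G x` expresses the determinant by Barnes functions. -/

/-! ### The branching rule for skew Schur polynomials -/

section Branching

open YoungDiagram

variable {R : Type*} [CommRing R] {ka la nu : YoungDiagram} {n : ℕ}

open scoped Classical in
/-- The value of the skew Schur polynomial `s_{ka/la}` at a point `x`. The point may have
coordinates in any ring, so that `x = X` gives back the polynomial itself. -/
noncomputable def skewSchurEval (ka la : YoungDiagram) (x : Fin n → R) : R :=
  if la ≤ ka then
    ∑ T : {c : ℕ × ℕ // c ∈ ka.cells \ la.cells} → Fin n with T ∈ skewTableaux ka la n,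
      ∏ c, x (T c)
  else 0

theorem skewSchur_eq_skewSchurEval_X (ka la : YoungDiagram) (n : ℕ) :
    skewSchur R ka la n = skewSchurEval ka la MvPolynomial.X := rfl

theorem eval_skewSchur (ka la : YoungDiagram) (x : Fin n → R) :
    MvPolynomial.eval x (skewSchur R ka la n) = skewSchurEval ka la x := by
  unfold skewSchur skewSchurEval
  split_ifs <;> simp

theorem skewSchurEval_of_not_le (h : ¬ la ≤ ka) (x : Fin n → R) : skewSchurEval ka la x = 0 :=
  if_neg h

/-- The cells of the skew diagram `ka / la`. -/
abbrev SkewCell (ka la : YoungDiagram) : Type := {c : ℕ × ℕ // c ∈ ka.cells \ la.cells}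

theorem mem_cells_sdiff_cells {c : ℕ × ℕ} : c ∈ ka.cells \ la.cells ↔ c ∈ ka ∧ c ∉ la := by
  simp only [Finset.mem_sdiff, mem_cells]

open scoped Classical in
theorem skewSchurEval_self (ka : YoungDiagram) (x : Fin n → R) : skewSchurEval ka ka x = 1 := by
  have : IsEmpty (SkewCell ka ka) := ⟨fun c => (mem_cells_sdiff_cells.1 c.2).2
    (mem_cells_sdiff_cells.1 c.2).1⟩
  rw [skewSchurEval, if_pos le_rfl, Finset.filter_true_of_mem fun T _ => ⟨isEmptyElim, isEmptyElim⟩]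
  simp

open scoped Classical in
theorem skewSchurEval_zero_vars (ka la : YoungDiagram) (x : Fin 0 → R) :
    skewSchurEval ka la x = if ka = la then 1 else 0 := by
  split_ifs with h
  · rw [h, skewSchurEval_self]
  · by_cases hle : la ≤ ka
    · obtain ⟨c, hc⟩ := SetLike.exists_of_lt (lt_of_le_of_ne hle (Ne.symm h))
      have : IsEmpty (SkewCell ka la → Fin 0) :=
        ⟨fun T => (T ⟨c, mem_cells_sdiff_cells.2 hc⟩).elim0⟩
      rw [skewSchurEval, if_pos hle]
      exact Finset.sum_of_isEmpty _
    · exact skewSchurEval_of_not_le hle x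

theorem finite_Iic_youngDiagram (ka : YoungDiagram) : (Set.Iic ka).Finite :=
  (ka.cells.powerset.finite_toSet.preimage fun _ _ _ _ => YoungDiagram.ext).subset
    fun _ h => Finset.mem_coe.2 (Finset.mem_powerset.2 (cells_subset_iff.2 h))

/-- The skew diagram `ka / nu` is a horizontal strip: it has at most one cell in each column. -/
def IsHorizontalStrip (ka nu : YoungDiagram) : Prop :=
  nu ≤ ka ∧ ∀ i j, (i + 1, j) ∈ ka → (i, j) ∈ nu

open scoped Classical in
/-- The diagrams that are left when a horizontal strip is removed from `ka`, the index set of the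
branching rule. -/
noncomputable def horizontalStrips (ka : YoungDiagram) : Finset YoungDiagram :=
  (finite_Iic_youngDiagram ka).toFinset.filter (IsHorizontalStrip ka)

theorem mem_horizontalStrips : nu ∈ horizontalStrips ka ↔ IsHorizontalStrip ka nu := by
  simpa only [horizontalStrips, Finset.mem_filter, Set.Finite.mem_toFinset, Set.mem_Iic,
    and_iff_right_iff_imp] using fun h : IsHorizontalStrip ka nu => h.1

theorem monotone_of_mem_skewTableaux {T : SkewCell ka la → Fin n} (hT : T ∈ skewTableaux ka la n) :
    Monotone T := by
  rintro ⟨⟨i, j⟩, hc⟩ ⟨⟨i', j'⟩, hc'⟩ ⟨hi : i ≤ i', hj : j ≤ j'⟩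
  have hcorner : (i, j') ∈ ka.cells \ la.cells := by
    rw [mem_cells_sdiff_cells] at hc hc' ⊢
    exact ⟨ka.up_left_mem hi le_rfl hc'.1, fun h => hc.2 (la.up_left_mem le_rfl hj h)⟩
  calc T ⟨(i, j), hc⟩ ≤ T ⟨(i, j'), hcorner⟩ := by
        rcases hj.eq_or_lt with rfl | hj
        · exact le_rfl
        · exact hT.1 _ _ rfl hj
    _ ≤ T ⟨(i', j'), hc'⟩ := by
        rcases hi.eq_or_lt with rfl | hi
        · exact le_rfl
        · exact (hT.2 ⟨(i, j'), hcorner⟩ ⟨(i', j'), hc'⟩ rfl hi).le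

/-- The filling of `ka / la` that extends a filling of `nu / la` by a new largest letter. -/
noncomputable def extendFilling (ka : YoungDiagram) (T : SkewCell nu la → Fin n) :
    SkewCell ka la → Fin (n + 1) :=
  fun c => if h : c.1 ∈ nu.cells \ la.cells then (T ⟨c.1, h⟩).castSucc else Fin.last n

theorem extendFilling_of_mem {T : SkewCell nu la → Fin n} {c : SkewCell ka la}
    (h : c.1 ∈ nu.cells \ la.cells) : extendFilling ka T c = (T ⟨c.1, h⟩).castSucc :=
  dif_pos h

theorem extendFilling_of_notMem {T : SkewCell nu la → Fin n} {c : SkewCell ka la}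
    (h : c.1 ∉ nu.cells \ la.cells) : extendFilling ka T c = Fin.last n :=
  dif_neg h

theorem extendFilling_ne_last_iff {T : SkewCell nu la → Fin n} {c : SkewCell ka la} :
    extendFilling ka T c ≠ Fin.last n ↔ c.1 ∈ nu := by
  have hla : c.1 ∉ la := (mem_cells_sdiff_cells.1 c.2).2
  by_cases h : c.1 ∈ nu
  · simp [extendFilling_of_mem (mem_cells_sdiff_cells.2 ⟨h, hla⟩), h, Fin.castSucc_ne_last]
  · simp [extendFilling_of_notMem fun hc => h (mem_cells_sdiff_cells.1 hc).1, h]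

theorem extendFilling_mem_skewTableaux (hs : IsHorizontalStrip ka nu) {T : SkewCell nu la → Fin n}
    (hT : T ∈ skewTableaux nu la n) : extendFilling ka T ∈ skewTableaux ka la (n + 1) := by
  refine ⟨fun c c' hrow hlt => ?_, fun c c' hcol hlt => ?_⟩
  · by_cases h' : c'.1 ∈ nu.cells \ la.cells
    · have h : c.1 ∈ nu.cells \ la.cells := mem_cells_sdiff_cells.2
        ⟨nu.up_left_mem hrow.le hlt.le (mem_cells_sdiff_cells.1 h').1,
          (mem_cells_sdiff_cells.1 c.2).2⟩
      rw [extendFilling_of_mem h, extendFilling_of_mem h', Fin.castSucc_le_castSucc_iff]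
      exact hT.1 _ _ hrow hlt
    · rw [extendFilling_of_notMem h']
      exact Fin.le_last _
  · have h : c.1 ∈ nu.cells \ la.cells := mem_cells_sdiff_cells.2
      ⟨hs.2 _ _ (ka.up_left_mem hlt hcol.le (mem_cells_sdiff_cells.1 c'.2).1),
        (mem_cells_sdiff_cells.1 c.2).2⟩
    by_cases h' : c'.1 ∈ nu.cells \ la.cells
    · rw [extendFilling_of_mem h, extendFilling_of_mem h', Fin.castSucc_lt_castSucc_iff]
      exact hT.2 _ _ hcol hlt
    · rw [extendFilling_of_mem h, extendFilling_of_notMem h']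
      exact Fin.castSucc_lt_last _

theorem eq_of_extendFilling_eq {nu' : YoungDiagram} (hk : nu ≤ ka) (hk' : nu' ≤ ka) (hl : la ≤ nu)
    (hl' : la ≤ nu') {T : SkewCell nu la → Fin n} {T' : SkewCell nu' la → Fin n}
    (h : extendFilling ka T = extendFilling ka T') : nu = nu' := by
  refine SetLike.ext fun c => ?_
  by_cases hc : c ∈ ka.cells \ la.cells
  · rw [← extendFilling_ne_last_iff (T := T) (c := ⟨c, hc⟩), h, extendFilling_ne_last_iff]
  · rw [mem_cells_sdiff_cells, not_and_not_right] at hc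
    exact ⟨fun h => hl' (hc (hk h)), fun h => hl (hc (hk' h))⟩

theorem extendFilling_injective (hk : nu ≤ ka) :
    Function.Injective (extendFilling ka : (SkewCell nu la → Fin n) → _) := by
  intro T T' h
  funext c
  have hc : c.1 ∈ ka.cells \ la.cells := Finset.sdiff_subset_sdiff (cells_subset_iff.2 hk)
    Finset.Subset.rfl c.2
  have := congrFun h ⟨c.1, hc⟩
  rw [extendFilling_of_mem (c := ⟨c.1, hc⟩) c.2, extendFilling_of_mem (c := ⟨c.1, hc⟩) c.2] at this
  exact Fin.castSucc_injective _ this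

open scoped Classical in
/-- The cells of a tableau whose entry is not the largest letter, together with the inner
shape. -/
noncomputable def shapeWithoutLast {T : SkewCell ka la → Fin (n + 1)}
    (hT : T ∈ skewTableaux ka la (n + 1)) : YoungDiagram where
  cells := ka.cells.filter fun c => ∀ h : c ∈ ka.cells \ la.cells, T ⟨c, h⟩ ≠ Fin.last n
  isLowerSet := by
    intro c c' hle hc
    simp only [Finset.coe_filter, mem_cells, Set.mem_ofPred_eq] at hc ⊢
    refine ⟨ka.isLowerSet hle hc.1, fun hc' hlast => ?_⟩
    have hmem : c ∈ ka.cells \ la.cells := mem_cells_sdiff_cells.2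
      ⟨hc.1, fun h => (mem_cells_sdiff_cells.1 hc').2 (la.isLowerSet hle h)⟩
    refine hc.2 hmem (Fin.last_le_iff.1 ?_)
    rw [← hlast]
    exact monotone_of_mem_skewTableaux hT hle

theorem mem_shapeWithoutLast {T : SkewCell ka la → Fin (n + 1)}
    {hT : T ∈ skewTableaux ka la (n + 1)} {c : ℕ × ℕ} :
    c ∈ shapeWithoutLast hT ↔
      c ∈ ka ∧ ∀ h : c ∈ ka.cells \ la.cells, T ⟨c, h⟩ ≠ Fin.last n := by
  rw [← mem_cells]
  simp [shapeWithoutLast]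

theorem isHorizontalStrip_shapeWithoutLast {T : SkewCell ka la → Fin (n + 1)}
    (hT : T ∈ skewTableaux ka la (n + 1)) : IsHorizontalStrip ka (shapeWithoutLast hT) := by
  refine ⟨fun c hc => (mem_shapeWithoutLast.1 hc).1, fun i j hij => mem_shapeWithoutLast.2
    ⟨ka.up_left_mem i.le_succ le_rfl hij, fun h => ?_⟩⟩
  have hbelow : (i + 1, j) ∈ ka.cells \ la.cells := mem_cells_sdiff_cells.2
    ⟨hij, fun hl => (mem_cells_sdiff_cells.1 h).2 (la.up_left_mem i.le_succ le_rfl hl)⟩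
  exact ((hT.2 ⟨(i, j), h⟩ ⟨(i + 1, j), hbelow⟩ rfl i.lt_succ_self).trans_le (Fin.le_last _)).ne

theorem le_shapeWithoutLast (hle : la ≤ ka) {T : SkewCell ka la → Fin (n + 1)}
    (hT : T ∈ skewTableaux ka la (n + 1)) : la ≤ shapeWithoutLast hT :=
  fun _ hc => mem_shapeWithoutLast.2
    ⟨hle hc, fun h => absurd hc (mem_cells_sdiff_cells.1 h).2⟩

theorem exists_extendFilling_eq {T : SkewCell ka la → Fin (n + 1)}
    (hT : T ∈ skewTableaux ka la (n + 1)) :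
    ∃ T' ∈ skewTableaux (shapeWithoutLast hT) la n, extendFilling ka T' = T := by
  have hmem : ∀ c : SkewCell (shapeWithoutLast hT) la, c.1 ∈ ka.cells \ la.cells := fun c =>
    mem_cells_sdiff_cells.2 ⟨(mem_shapeWithoutLast.1 (mem_cells_sdiff_cells.1 c.2).1).1,
      (mem_cells_sdiff_cells.1 c.2).2⟩
  have hne : ∀ c : SkewCell (shapeWithoutLast hT) la, T ⟨c.1, hmem c⟩ ≠ Fin.last n := fun c =>
    (mem_shapeWithoutLast.1 (mem_cells_sdiff_cells.1 c.2).1).2 (hmem c)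
  refine ⟨fun c => (T ⟨c.1, hmem c⟩).castPred (hne c),
    ⟨fun c c' => hT.1 ⟨c.1, hmem c⟩ ⟨c'.1, hmem c'⟩,
      fun c c' => hT.2 ⟨c.1, hmem c⟩ ⟨c'.1, hmem c'⟩⟩, funext fun c => ?_⟩
  by_cases h : c.1 ∈ (shapeWithoutLast hT).cells \ la.cells
  · rw [extendFilling_of_mem h, Fin.castSucc_castPred]
  · rw [extendFilling_of_notMem h]
    by_contra hlast
    have hc := mem_cells_sdiff_cells.1 c.2
    exact h (mem_cells_sdiff_cells.2
      ⟨mem_shapeWithoutLast.2 ⟨hc.1, fun _ => Ne.symm hlast⟩, hc.2⟩)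

theorem prod_extendFilling (hk : nu ≤ ka) (hl : la ≤ nu) (x : Fin (n + 1) → R)
    (T : SkewCell nu la → Fin n) :
    ∏ c, x (extendFilling ka T c) =
      x (Fin.last n) ^ (ka.cells \ nu.cells).card * ∏ c, x (T c).castSucc := by
  let entry : ℕ × ℕ → R := fun c =>
    if h : c ∈ nu.cells \ la.cells then x (T ⟨c, h⟩).castSucc else x (Fin.last n)
  have hnew : ∏ c ∈ ka.cells \ nu.cells, entry c = x (Fin.last n) ^ (ka.cells \ nu.cells).card :=
    Finset.prod_eq_pow_card fun c hc => dif_neg fun h =>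
      (mem_cells_sdiff_cells.1 hc).2 (mem_cells_sdiff_cells.1 h).1
  have hold : ∏ c ∈ nu.cells \ la.cells, entry c = ∏ c, x (T c).castSucc := by
    rw [← Finset.prod_coe_sort]
    exact Finset.prod_congr rfl fun c _ => dif_pos c.2
  calc ∏ c, x (extendFilling ka T c) = ∏ c ∈ ka.cells \ la.cells, entry c := by
        rw [← Finset.prod_coe_sort (ka.cells \ la.cells)]
        exact Finset.prod_congr rfl fun c _ => apply_dite x _ _ _
    _ = ∏ c ∈ ka.cells \ nu.cells ∪ nu.cells \ la.cells, entry c := by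
        rw [Finset.sdiff_union_sdiff_cancel (cells_subset_iff.2 hk) (cells_subset_iff.2 hl)]
    _ = _ := by
        rw [Finset.prod_union (Finset.disjoint_sdiff.symm.mono_right Finset.sdiff_subset), hnew,
          hold]

open scoped Classical in
theorem pow_mul_skewSchurEval_eq_sum_extendFilling (hk : nu ≤ ka) (hl : la ≤ nu)
    (x : Fin (n + 1) → R) :
    x (Fin.last n) ^ (ka.cells \ nu.cells).card *
        skewSchurEval nu la (fun i : Fin n => x i.castSucc) =
      ∑ T : SkewCell nu la → Fin n with T ∈ skewTableaux nu la n,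
        ∏ c, x (extendFilling ka T c) := by
  rw [skewSchurEval, if_pos hl, Finset.mul_sum]
  exact Finset.sum_congr rfl fun T _ => (prod_extendFilling hk hl x T).symm

open scoped Classical in
theorem skewSchurEval_succ (ka la : YoungDiagram) (x : Fin (n + 1) → R) :
    skewSchurEval ka la x = ∑ nu ∈ horizontalStrips ka,
      x (Fin.last n) ^ (ka.cells \ nu.cells).card *
        skewSchurEval nu la (fun i : Fin n => x i.castSucc) := by
  by_cases hle : la ≤ ka
  swap
  · rw [skewSchurEval_of_not_le hle]
    refine (Finset.sum_eq_zero fun nu hnu => ?_).symm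
    rw [skewSchurEval_of_not_le fun h => hle (h.trans (mem_horizontalStrips.1 hnu).1), mul_zero]
  rw [← Finset.sum_filter_of_ne (p := fun nu => la ≤ nu) fun nu _ hne => not_not.1 fun hn =>
      hne (by rw [skewSchurEval_of_not_le hn, mul_zero]),
    Finset.sum_congr rfl fun nu hnu => pow_mul_skewSchurEval_eq_sum_extendFilling
      (mem_horizontalStrips.1 (Finset.mem_filter.1 hnu).1).1 (Finset.mem_filter.1 hnu).2 x,
    Finset.sum_sigma', skewSchurEval, if_pos hle, eq_comm]
  refine Finset.sum_bij (fun p _ => extendFilling ka p.2) ?_ ?_ ?_ fun _ _ => rfl <;>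
    simp only [Finset.mem_sigma, Finset.mem_filter, mem_horizontalStrips, Finset.mem_univ,
      true_and]
  · exact fun p hp => extendFilling_mem_skewTableaux hp.1.1 hp.2
  · rintro ⟨nu, T⟩ ⟨⟨hnu, hl⟩, -⟩ ⟨nu', T'⟩ ⟨⟨hnu', hl'⟩, -⟩ heq
    dsimp only at hnu hl hnu' hl' heq
    obtain rfl := eq_of_extendFilling_eq hnu.1 hnu'.1 hl hl' heq
    exact congrArg _ (extendFilling_injective hnu.1 heq)
  · intro T hT
    obtain ⟨T', hT', heq⟩ := exists_extendFilling_eq hT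
    exact ⟨⟨_, T'⟩, ⟨⟨isHorizontalStrip_shapeWithoutLast hT, le_shapeWithoutLast hle hT⟩, hT'⟩, heq⟩

end Branching

/-! ### Partitions and their beta numbers -/

section BetaNumbers

open YoungDiagram

variable {ka nu : YoungDiagram} {N : ℕ}

theorem youngDiagram_le_iff_rowLen : nu ≤ ka ↔ ∀ i, nu.rowLen i ≤ ka.rowLen i := by
  refine ⟨fun h i => ?_, fun h c hc => ?_⟩
  · by_contra! hlt
    exact lt_irrefl _ (mem_iff_lt_rowLen.1 (h (mem_iff_lt_rowLen.2 hlt)))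
  · exact mem_iff_lt_rowLen.2 ((mem_iff_lt_rowLen.1 hc).trans_le (h c.1))

theorem colLen_zero_le_iff : ka.colLen 0 ≤ N ↔ ∀ i, N ≤ i → ka.rowLen i = 0 := by
  simp only [← not_lt, ← mem_iff_lt_colLen, mem_iff_lt_rowLen, Nat.pos_iff_ne_zero, ne_eq, not_not]
  exact ⟨fun h i hi => Nat.le_zero.1 (h ▸ ka.rowLen_anti N i (not_lt.1 hi)),
    fun h => h N (lt_irrefl N)⟩

theorem colLen_zero_le_of_le (h : nu ≤ ka) (hka : ka.colLen 0 ≤ N) : nu.colLen 0 ≤ N :=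
  colLen_zero_le_iff.2 fun i hi =>
    Nat.le_zero.1 (colLen_zero_le_iff.1 hka i hi ▸ youngDiagram_le_iff_rowLen.1 h i)

theorem youngDiagram_ext_rowLen (hka : ka.colLen 0 ≤ N) (hnu : nu.colLen 0 ≤ N)
    (h : ∀ i : Fin N, nu.rowLen i = ka.rowLen i) : nu = ka := by
  have hrow : ∀ i, nu.rowLen i = ka.rowLen i := fun i => by
    rcases lt_or_ge i N with hi | hi
    · exact h ⟨i, hi⟩
    · rw [colLen_zero_le_iff.1 hnu i hi, colLen_zero_le_iff.1 hka i hi]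
  exact le_antisymm (youngDiagram_le_iff_rowLen.2 fun i => (hrow i).le)
    (youngDiagram_le_iff_rowLen.2 fun i => (hrow i).ge)

theorem exists_youngDiagram_rowLen_eq {g : Fin N → ℕ} (hg : Antitone g) :
    ∃ nu : YoungDiagram, nu.colLen 0 ≤ N ∧ ∀ i : Fin N, nu.rowLen i = g i := by
  refine ⟨ofRowLens (List.ofFn g) hg.sortedGE_ofFn, ?_, fun i => ?_⟩
  · by_contra! hlt
    obtain ⟨h, -⟩ := mem_ofRowLens.1 (mem_iff_lt_colLen.2 hlt)
    simp at h
  · simpa using rowLen_ofRowLens (hw := hg.sortedGE_ofFn) (i.cast (List.length_ofFn (f := g)).symm)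

theorem card_sdiff_cells_eq_sum_rowLen (hka : ka.colLen 0 ≤ N) :
    (ka.cells \ nu.cells).card = ∑ i : Fin N, (ka.rowLen i - nu.rowLen i) := by
  have hrow : ∀ i, {c ∈ ka.cells \ nu.cells | c.1 = i} =
      {i} ×ˢ Finset.Ico (nu.rowLen i) (ka.rowLen i) := by
    intro i
    ext ⟨a, b⟩
    simp only [Finset.mem_filter, mem_cells_sdiff_cells, mem_iff_lt_rowLen, Finset.mem_product,
      Finset.mem_singleton, Finset.mem_Ico]
    grind
  have hmaps : ∀ c ∈ ka.cells \ nu.cells, c.1 ∈ Finset.range N := by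
    rintro ⟨a, b⟩ h
    have hcol := mem_iff_lt_colLen.1 (mem_cells_sdiff_cells.1 h).1
    exact Finset.mem_range.2 (hcol.trans_le ((ka.colLen_anti 0 b b.zero_le).trans hka))
  rw [Finset.card_eq_sum_card_fiberwise fun c hc => hmaps c (Finset.mem_coe.1 hc),
    Fin.sum_univ_eq_sum_range fun i => ka.rowLen i - nu.rowLen i]
  simp only [hrow, Finset.card_product, Finset.card_singleton, Nat.card_Ico, one_mul]

theorem card_sdiff_cells_transpose (ka nu : YoungDiagram) :
    (ka.transpose.cells \ nu.transpose.cells).card = (ka.cells \ nu.cells).card :=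
  Finset.card_equiv (Equiv.prodComm ℕ ℕ) fun c => by
    simp only [mem_cells_sdiff_cells, mem_transpose, Equiv.prodComm_apply]

theorem isHorizontalStrip_iff_rowLen :
    IsHorizontalStrip ka nu ↔ nu ≤ ka ∧ ∀ i, ka.rowLen (i + 1) ≤ nu.rowLen i := by
  refine and_congr_right fun _ => forall_congr' fun i => ?_
  simp only [mem_iff_lt_rowLen]
  exact ⟨le_of_forall_lt, fun h j hj => hj.trans_le h⟩

theorem isHorizontalStrip_transpose_iff_rowLen :
    IsHorizontalStrip ka.transpose nu.transpose ↔
      nu ≤ ka ∧ ∀ i, ka.rowLen i ≤ nu.rowLen i + 1 := by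
  simp only [IsHorizontalStrip, transpose_le_iff, mem_transpose, Prod.swap_prod_mk]
  simp only [mem_iff_lt_rowLen]
  refine and_congr_right fun _ => ⟨fun h i => ?_, fun h i j hij => ?_⟩
  · by_contra! hlt
    exact lt_irrefl _ (h (nu.rowLen i) i hlt)
  · exact Nat.lt_of_succ_lt_succ (hij.trans_le (h j))

/-- The `i`-th beta number `κ_{i+1} - i` of a partition. A partition of length at most `N` is
determined by its first `N` beta numbers, which form an arbitrary strictly decreasing sequence of
integers greater than `-N`. -/
def betaNumber (ka : YoungDiagram) (i : ℕ) : ℤ := ka.rowLen i - i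

theorem betaNumber_strictAnti (ka : YoungDiagram) : StrictAnti (betaNumber ka) := by
  refine strictAnti_nat_of_succ_lt fun i => ?_
  have := ka.rowLen_anti i (i + 1) i.le_succ
  simp only [betaNumber]
  lia

theorem neg_lt_betaNumber (ka : YoungDiagram) (i : Fin N) : -(N : ℤ) < betaNumber ka i := by
  have := i.2
  simp only [betaNumber]
  lia

theorem betaNumber_comp_val_inj (hka : ka.colLen 0 ≤ N) (hnu : nu.colLen 0 ≤ N) :
    (fun i : Fin N => betaNumber ka i) = (fun i : Fin N => betaNumber nu i) ↔ ka = nu := by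
  refine ⟨fun h => (youngDiagram_ext_rowLen hka hnu fun i => ?_).symm, fun h => h ▸ rfl⟩
  have := congrFun h i
  simp only [betaNumber] at this
  lia

theorem exists_betaNumber_eq {b : Fin N → ℤ} (hb : StrictAnti b) (hN : ∀ i, -(N : ℤ) < b i) :
    ∃ nu : YoungDiagram, nu.colLen 0 ≤ N ∧ ∀ i : Fin N, betaNumber nu i = b i := by
  cases N with
  | zero => exact ⟨⊥, not_lt.1 fun h => notMem_bot _ (mem_iff_lt_colLen.2 h), fun i => i.elim0⟩
  | succ n =>
    have hanti : Antitone fun i : Fin (n + 1) => b i + i := Fin.antitone_iff_succ_le.2 fun i => by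
      have := Fin.strictAnti_iff_succ_lt.1 hb i
      simp only [Fin.val_succ, Fin.val_castSucc, Nat.cast_succ]
      lia
    have hnonneg : ∀ i : Fin (n + 1), 0 ≤ b i + i := fun i => by
      refine le_trans ?_ (hanti (Fin.le_last i))
      have := hN (Fin.last n)
      simp only [Fin.val_last]
      lia
    obtain ⟨nu, hlen, hrow⟩ := exists_youngDiagram_rowLen_eq (g := fun i => (b i + i).toNat)
      fun i j hij => Int.toNat_le_toNat (hanti hij)
    refine ⟨nu, hlen, fun i => ?_⟩
    rw [betaNumber, hrow, Int.toNat_of_nonneg (hnonneg i), add_sub_cancel_right]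

end BetaNumbers

/-! ### The dual Jacobi–Trudi identity -/

section DualJacobiTrudi

open YoungDiagram

variable {R : Type*} [CommRing R] {n N : ℕ} {ka la nu : YoungDiagram}

open Polynomial in
/-- The elementary symmetric function `e_m` at the point `x`, zero for negative `m`. -/
noncomputable def elemSymm (x : Fin n → R) (m : ℤ) : R :=
  if 0 ≤ m then (∏ i, (1 + C (x i) * X)).coeff m.toNat else 0

theorem elemSymm_of_neg (x : Fin n → R) {m : ℤ} (hm : m < 0) : elemSymm x m = 0 :=
  if_neg hm.not_ge

theorem elemSymm_zero_vars (x : Fin 0 → R) (m : ℤ) :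
    elemSymm x m = if m = 0 then 1 else 0 := by
  simp only [elemSymm, Finset.univ_eq_empty, Finset.prod_empty, Polynomial.coeff_one]
  split_ifs <;> first | rfl | lia

theorem elemSymm_natCast (x : Fin n → R) (k : ℕ) :
    elemSymm x k = ∑ s ∈ Finset.powersetCard k Finset.univ, ∏ i ∈ s, x i := by
  have hcoeff : ∀ s : Finset (Fin n), (∏ i ∈ s, Polynomial.C (x i) * Polynomial.X).coeff k =
      if s.card = k then ∏ i ∈ s, x i else 0 := fun s => by
    rw [Finset.prod_mul_distrib, Finset.prod_const, ← map_prod, Polynomial.coeff_C_mul_X_pow]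
    exact if_congr eq_comm rfl rfl
  rw [elemSymm, if_pos (Int.natCast_nonneg k), Int.toNat_natCast, Finset.prod_one_add,
    Polynomial.finsetSum_coeff, Finset.powersetCard_eq_filter, Finset.sum_filter,
    Finset.powerset_univ]
  exact Finset.sum_congr rfl fun s _ => hcoeff s

theorem elemSymm_one (n : ℕ) (m : ℤ) :
    elemSymm (fun _ : Fin n => (1 : R)) m = if 0 ≤ m then (n.choose m.toNat : R) else 0 := by
  split_ifs with h
  · lift m to ℕ using h
    simp [elemSymm_natCast]
  · exact elemSymm_of_neg _ (not_le.1 h)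

theorem elemSymm_succ (x : Fin (n + 1) → R) (m : ℤ) :
    elemSymm x m = x (Fin.last n) * elemSymm (fun i : Fin n => x i.castSucc) (m - 1) +
      elemSymm (fun i : Fin n => x i.castSucc) m := by
  rcases lt_or_ge m 0 with hm | hm
  · simp only [elemSymm_of_neg _ hm, elemSymm_of_neg _ (show m - 1 < 0 by lia), mul_zero, add_zero]
  lift m to ℕ using hm
  cases m with
  | zero => simp [elemSymm, Fin.prod_univ_castSucc]
  | succ k =>
    rw [Nat.cast_succ, add_sub_cancel_right, ← Nat.cast_succ]
    simp only [elemSymm, Int.natCast_nonneg, if_true, Int.toNat_natCast, Fin.prod_univ_castSucc]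
    rw [mul_add, mul_one, mul_left_comm, Polynomial.coeff_add, Polynomial.coeff_C_mul,
      Polynomial.coeff_mul_X, add_comm]

theorem det_elemSymm_succ (x : Fin (n + 1) → R) (a b : Fin N → ℤ) :
    Matrix.det (Matrix.of fun i j => elemSymm x (a i - b j)) =
      ∑ s : Finset (Fin N), x (Fin.last n) ^ s.card *
        Matrix.det (Matrix.of fun i j =>
          elemSymm (fun i : Fin n => x i.castSucc) ((a i - if i ∈ s then 1 else 0) - b j)) := by
  set y : Fin n → R := fun i => x i.castSucc
  have hrows : (Matrix.of fun i j => elemSymm x (a i - b j)) =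
      (fun i j => x (Fin.last n) * elemSymm y (a i - 1 - b j)) +
        (fun i j => elemSymm y (a i - b j)) := by
    funext i j
    rw [Matrix.of_apply, elemSymm_succ, sub_right_comm]
    rfl
  rw [hrows]
  refine ((Matrix.detRowAlternating (R := R) (n := Fin N)).toMultilinearMap.map_add_univ _
    _).trans (Finset.sum_congr rfl fun s _ => ?_)
  have hpow : x (Fin.last n) ^ s.card = ∏ i, if i ∈ s then x (Fin.last n) else 1 := by
    rw [Finset.prod_ite_mem, Finset.univ_inter, Finset.prod_const]
  rw [hpow, ← Matrix.det_mul_column]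
  refine congrArg Matrix.det (funext₂ fun i j => ?_)
  by_cases hi : i ∈ s <;> simp [Finset.piecewise, hi]

theorem det_ite_eq_of_strictAnti {α : Type*} [LinearOrder α] {a b : Fin N → α}
    (ha : StrictAnti a) (hb : StrictAnti b) :
    Matrix.det (Matrix.of fun i j => if a i = b j then (1 : R) else 0) =
      if a = b then 1 else 0 := by
  split_ifs with h
  · subst h
    refine (congrArg Matrix.det (Matrix.ext fun i j => ?_)).trans Matrix.det_one
    simp only [Matrix.of_apply, Matrix.one_apply, ha.injective.eq_iff]
  · have hrow : ∃ i, ∀ j, a i ≠ b j := by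
      by_contra! hsub
      refine h ((StrictAnti.range_inj ha hb).1 ?_)
      refine Set.eq_of_subset_of_ncard_le (fun _ ⟨i, hi⟩ => ?_) ?_ (Set.finite_range b)
      · obtain ⟨j, hj⟩ := hsub i
        exact ⟨j, hj.symm.trans hi⟩
      · rw [Set.ncard_range_of_injective ha.injective, Set.ncard_range_of_injective hb.injective]
    obtain ⟨i, hi⟩ := hrow
    exact Matrix.det_eq_zero_of_row_eq_zero i fun j => if_neg (hi j)

/-- The rows among the first `N` in which the skew diagram `ka / nu` has a cell. -/
def stripRows (N : ℕ) (ka nu : YoungDiagram) : Finset (Fin N) :=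
  {i | nu.rowLen i < ka.rowLen i}

theorem mem_stripRows {i : Fin N} : i ∈ stripRows N ka nu ↔ nu.rowLen i < ka.rowLen i := by
  simp only [stripRows, Finset.mem_filter, Finset.mem_univ, true_and]

theorem betaNumber_of_isHorizontalStrip_transpose
    (h : IsHorizontalStrip ka.transpose nu.transpose) (i : Fin N) :
    betaNumber nu i = betaNumber ka i - if i ∈ stripRows N ka nu then 1 else 0 := by
  obtain ⟨hle, hstrip⟩ := isHorizontalStrip_transpose_iff_rowLen.1 h
  have hle := youngDiagram_le_iff_rowLen.1 hle i
  have hstrip := hstrip i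
  simp only [mem_stripRows, betaNumber]
  split_ifs <;> lia

theorem card_sdiff_cells_of_isHorizontalStrip_transpose (hka : ka.colLen 0 ≤ N)
    (h : IsHorizontalStrip ka.transpose nu.transpose) :
    (ka.cells \ nu.cells).card = (stripRows N ka nu).card := by
  rw [card_sdiff_cells_eq_sum_rowLen hka, stripRows, Finset.card_filter]
  refine Finset.sum_congr rfl fun i _ => ?_
  obtain ⟨hle, hstrip⟩ := isHorizontalStrip_transpose_iff_rowLen.1 h
  have hle := youngDiagram_le_iff_rowLen.1 hle i
  have hstrip := hstrip i
  split_ifs <;> lia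

theorem isHorizontalStrip_transpose_of_betaNumber (hka : ka.colLen 0 ≤ N) (hnu : nu.colLen 0 ≤ N)
    {s : Finset (Fin N)}
    (h : ∀ i : Fin N, betaNumber nu i = betaNumber ka i - if i ∈ s then 1 else 0) :
    IsHorizontalStrip ka.transpose nu.transpose ∧ stripRows N ka nu = s := by
  have hrow : ∀ i : Fin N, (nu.rowLen i : ℤ) = ka.rowLen i - if i ∈ s then 1 else 0 := fun i => by
    have := h i
    simp only [betaNumber] at this
    lia
  have hdiff : ∀ i, nu.rowLen i ≤ ka.rowLen i ∧ ka.rowLen i ≤ nu.rowLen i + 1 := fun i => by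
    rcases lt_or_ge i N with hi | hi
    · have := hrow ⟨i, hi⟩
      split_ifs at this <;> simp only at this <;> lia
    · simp only [colLen_zero_le_iff.1 hka i hi, colLen_zero_le_iff.1 hnu i hi, le_refl, zero_le,
        and_self]
  refine ⟨isHorizontalStrip_transpose_iff_rowLen.2 ⟨youngDiagram_le_iff_rowLen.2 fun i =>
    (hdiff i).1, fun i => (hdiff i).2⟩, Finset.ext fun i => ?_⟩
  rw [mem_stripRows]
  have := hrow i
  split_ifs at this with hi <;> simp only [hi, iff_true, iff_false] <;> lia

/-- Lowering some beta numbers by one keeps them weakly decreasing. They fail to be the beta numbers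
of a partition only if two of them become equal or the last one becomes `-N`; then the determinant
has two equal rows or a zero row. -/
theorem det_elemSymm_eq_zero_or_exists_betaNumber_eq (y : Fin n → R) (ka la : YoungDiagram)
    (s : Finset (Fin N)) :
    Matrix.det (Matrix.of fun i j : Fin N => elemSymm y
        ((betaNumber ka i - if i ∈ s then 1 else 0) - betaNumber la j)) = 0 ∨
      ∃ nu : YoungDiagram, nu.colLen 0 ≤ N ∧
        ∀ i : Fin N, betaNumber nu i = betaNumber ka i - if i ∈ s then 1 else 0 := by
  set b : Fin N → ℤ := fun i => betaNumber ka i - if i ∈ s then 1 else 0 with hb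
  have hanti : Antitone b := by
    refine antitone_iff_forall_lt.2 fun i j hij => ?_
    have := betaNumber_strictAnti ka (Fin.lt_def.1 hij)
    simp only [hb]
    split_ifs <;> lia
  by_cases hinj : Function.Injective b
  · by_cases hlow : ∀ i, -(N : ℤ) < b i
    · exact Or.inr (exists_betaNumber_eq (hanti.strictAnti_of_injective hinj) hlow)
    · push Not at hlow
      obtain ⟨i, hi⟩ := hlow
      exact Or.inl (Matrix.det_eq_zero_of_row_eq_zero i fun j =>
        elemSymm_of_neg y (sub_neg.2 (hi.trans_lt (neg_lt_betaNumber la j))))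
  · obtain ⟨i, j, hij, hne⟩ := Function.not_injective_iff.1 hinj
    exact Or.inl (Matrix.det_zero_of_row_eq hne (funext fun k =>
      congrArg (fun c => elemSymm y (c - betaNumber la k)) hij))

theorem sum_horizontalStrips_transpose (hka : ka.colLen 0 ≤ N) (z : R) (F : YoungDiagram → R)
    (G : (Fin N → ℤ) → R)
    (hFG : ∀ nu : YoungDiagram, nu.colLen 0 ≤ N →
      F nu.transpose = G fun i => betaNumber nu i)
    (hG : ∀ s : Finset (Fin N), G (fun i => betaNumber ka i - if i ∈ s then 1 else 0) = 0 ∨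
      ∃ nu : YoungDiagram, nu.colLen 0 ≤ N ∧
        ∀ i : Fin N, betaNumber nu i = betaNumber ka i - if i ∈ s then 1 else 0) :
    ∑ nu ∈ horizontalStrips ka.transpose, z ^ (ka.transpose.cells \ nu.cells).card * F nu =
      ∑ s : Finset (Fin N), z ^ s.card * G fun i => betaNumber ka i - if i ∈ s then 1 else 0 := by
  have hstrip : ∀ nu ∈ horizontalStrips ka.transpose,
      IsHorizontalStrip ka.transpose nu.transpose.transpose := fun nu hnu => by
    rwa [transpose_transpose, ← mem_horizontalStrips]
  have hlen : ∀ nu ∈ horizontalStrips ka.transpose, nu.transpose.colLen 0 ≤ N := fun nu hnu =>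
    colLen_zero_le_of_le (isHorizontalStrip_transpose_iff_rowLen.1 (hstrip nu hnu)).1 hka
  refine Finset.sum_of_injOn (fun nu => stripRows N ka nu.transpose) ?_
    (fun _ _ => Finset.mem_coe.2 (Finset.mem_univ _)) ?_ ?_
  · intro nu hnu nu' hnu' heq
    rw [← transpose_eq_iff, ← betaNumber_comp_val_inj (hlen nu hnu) (hlen nu' hnu')]
    funext i
    rw [betaNumber_of_isHorizontalStrip_transpose (hstrip nu hnu),
      betaNumber_of_isHorizontalStrip_transpose (hstrip nu' hnu')]
    simp only [heq]
  · intro s _ hs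
    refine (hG s).elim (fun h => by rw [h, mul_zero]) fun ⟨nu, hnu, hbeta⟩ => absurd ?_ hs
    obtain ⟨hnu, rfl⟩ := isHorizontalStrip_transpose_of_betaNumber hka hnu hbeta
    exact ⟨nu.transpose, Finset.mem_coe.2 (mem_horizontalStrips.2 hnu),
      by simp only [transpose_transpose]⟩
  · intro nu hnu
    rw [← card_sdiff_cells_of_isHorizontalStrip_transpose hka (hstrip nu hnu),
      ← card_sdiff_cells_transpose ka, transpose_transpose]
    conv_lhs => rw [← nu.transpose_transpose, hFG _ (hlen nu hnu)]
    simp only [betaNumber_of_isHorizontalStrip_transpose (hstrip nu hnu), transpose_transpose]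

theorem skewSchurEval_transpose (x : Fin n → R) (hka : ka.colLen 0 ≤ N) (hla : la.colLen 0 ≤ N) :
    skewSchurEval ka.transpose la.transpose x =
      Matrix.det (Matrix.of fun i j : Fin N => elemSymm x (betaNumber ka i - betaNumber la j)) := by
  induction n generalizing ka with
  | zero =>
    classical
    simp only [skewSchurEval_zero_vars, elemSymm_zero_vars, sub_eq_zero]
    rw [det_ite_eq_of_strictAnti (fun _ _ h => betaNumber_strictAnti ka h)
      (fun _ _ h => betaNumber_strictAnti la h)]
    exact if_congr (transpose_eq_iff.trans (betaNumber_comp_val_inj hka hla).symm) rfl rfl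
  | succ n ih =>
    rw [skewSchurEval_succ, det_elemSymm_succ x]
    exact sum_horizontalStrips_transpose hka (x (Fin.last n)) _
      (fun b => Matrix.det (Matrix.of fun i j : Fin N =>
        elemSymm (fun i : Fin n => x i.castSucc) (b i - betaNumber la j)))
      (fun nu hnu => ih _ hnu) (det_elemSymm_eq_zero_or_exists_betaNumber_eq _ ka la)

end DualJacobiTrudi

/-! ### The bialternant formula -/

section Bialternant

open YoungDiagram

variable {R : Type*} [CommRing R] {n : ℕ} {la nu : YoungDiagram}

theorem skewSchurEval_bot_of_lt_colLen (x : Fin n → R) (h : n < la.colLen 0) :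
    skewSchurEval la ⊥ x = 0 := by
  induction n generalizing la with
  | zero =>
    rw [skewSchurEval_zero_vars, if_neg]
    rintro rfl
    exact notMem_bot _ (mem_iff_lt_colLen.2 h)
  | succ n ih =>
    rw [skewSchurEval_succ]
    refine Finset.sum_eq_zero fun nu hnu => ?_
    rw [ih _ (mem_iff_lt_colLen.1 ((mem_horizontalStrips.1 hnu).2 n 0 (mem_iff_lt_colLen.2 h))),
      mul_zero]

theorem det_eq_of_forall_col_eq_smul_add_succ {A B : Matrix (Fin (n + 1)) (Fin (n + 1)) R}
    (c : Fin n → R) (hlast : ∀ i, A i (Fin.last n) = B i (Fin.last n))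
    (hcastSucc : ∀ i (j : Fin n), A i j.castSucc = B i j.castSucc + c j * A i j.succ) :
    A.det = B.det := by
  rw [← Matrix.det_submatrix_equiv_self Fin.revPerm A,
    ← Matrix.det_submatrix_equiv_self Fin.revPerm B]
  refine Matrix.det_eq_of_forall_col_eq_smul_add_pred (fun j => c j.rev) (fun i => ?_)
    fun i j => ?_
  · simp only [Matrix.submatrix_apply, Fin.revPerm_apply, Fin.rev_zero, hlast]
  · simp only [Matrix.submatrix_apply, Fin.revPerm_apply, Fin.rev_succ, Fin.rev_castSucc, hcastSucc]

/-- Subtracting from each column a multiple of the next one clears all but the last entry of the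
last row. -/
theorem det_pow_succ (x : Fin (n + 1) → R) {m : Fin (n + 1) → ℕ}
    (hm : ∀ j : Fin n, m j.succ ≤ m j.castSucc) :
    Matrix.det (Matrix.of fun i j => x i ^ m j) =
      (∏ i : Fin n, (x i.castSucc - x (Fin.last n))) * x (Fin.last n) ^ m (Fin.last n) *
        Matrix.det (Matrix.of fun i j : Fin n => ∑ p ∈ Finset.Ico (m j.succ) (m j.castSucc),
          x i.castSucc ^ p * x (Fin.last n) ^ (m j.castSucc - 1 - p)) := by
  set z := x (Fin.last n) with hz
  let B : Matrix (Fin (n + 1)) (Fin (n + 1)) R := Matrix.of fun i =>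
    Fin.lastCases (motive := fun _ => R) (x i ^ m (Fin.last n))
      (fun j => x i ^ m j.castSucc - x i ^ m j.succ * z ^ (m j.castSucc - m j.succ))
  have hlast : ∀ i, B i (Fin.last n) = x i ^ m (Fin.last n) := fun i => by
    simp only [B, Matrix.of_apply, Fin.lastCases_last]
  have hcastSucc : ∀ i (j : Fin n), B i j.castSucc =
      x i ^ m j.castSucc - x i ^ m j.succ * z ^ (m j.castSucc - m j.succ) := fun i j => by
    simp only [B, Matrix.of_apply, Fin.lastCases_castSucc]
  have hrow : ∀ j : Fin n, B (Fin.last n) j.castSucc = 0 := fun j => by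
    rw [hcastSucc, ← hz, ← pow_add, Nat.add_sub_cancel' (hm j), sub_self]
  rw [det_eq_of_forall_col_eq_smul_add_succ (B := B) (fun j => z ^ (m j.castSucc - m j.succ))
      (fun i => (hlast i).symm) fun i j => by simp only [hcastSucc, Matrix.of_apply]; ring,
    Matrix.det_succ_row B (Fin.last n), Fin.sum_univ_castSucc]
  simp only [hrow, hlast, ← hz, mul_zero, zero_mul, Finset.sum_const_zero, zero_add, ← two_mul,
    pow_mul, neg_one_sq, one_pow, one_mul]
  rw [mul_comm (∏ _, _), mul_assoc, ← Matrix.det_mul_column]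
  refine congrArg (_ * Matrix.det ·) (Matrix.ext fun i j => ?_)
  rw [Matrix.submatrix_apply, Fin.succAbove_last, hcastSucc, Matrix.of_apply, Matrix.of_apply,
    mul_geom_sum₂_Ico _ _ (hm j)]

theorem det_sum_mul (A : Fin n → Finset ℕ) (c : Fin n → ℕ → R) (v : ℕ → Fin n → R) :
    Matrix.det (Matrix.of fun i j : Fin n => ∑ p ∈ A j, v p i * c j p) =
      ∑ r ∈ Fintype.piFinset A, (∏ j, c j (r j)) * Matrix.det (Matrix.of fun i j => v (r j) i) := by
  have hexpand := (Matrix.detRowAlternating (R := R) (n := Fin n)).toMultilinearMap.map_sum_finset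
    (fun j p i => v p i * c j p) A
  rw [← Matrix.det_transpose]
  refine Eq.trans (congrArg Matrix.det (Matrix.ext fun j i => ?_))
    (hexpand.trans (Finset.sum_congr rfl fun r _ => ?_))
  · simp only [Matrix.transpose_apply, Matrix.of_apply, Finset.sum_apply]
  · rw [← Matrix.det_mul_row, ← Matrix.det_transpose]
    exact congrArg Matrix.det (Matrix.ext fun j i => mul_comm _ _)

/-- The exponents of the alternant of a partition, in decreasing order. -/
def alternantExponent (la : YoungDiagram) (j : Fin n) : ℕ := la.rowLen j + j.rev

/-- The alternant of a partition at a point `x`, the numerator in the bialternant formula. The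
alternant of the empty partition is the Vandermonde determinant. -/
def alternant (la : YoungDiagram) (x : Fin n → R) : R :=
  Matrix.det (Matrix.of fun i j => x i ^ alternantExponent la j)

theorem alternantExponent_succ (la : YoungDiagram) (j : Fin n) :
    alternantExponent la j.succ = la.rowLen (j + 1) + j.rev := by
  simp only [alternantExponent, Fin.rev_succ, Fin.val_succ, Fin.val_castSucc]

theorem alternantExponent_castSucc (la : YoungDiagram) (j : Fin n) :
    alternantExponent la j.castSucc = la.rowLen j + j.rev + 1 := by
  simp only [alternantExponent, Fin.rev_castSucc, Fin.val_succ, Fin.val_castSucc, add_assoc]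

theorem alternantExponent_succ_le_castSucc (la : YoungDiagram) (j : Fin n) :
    alternantExponent la j.succ ≤ alternantExponent la j.castSucc := by
  rw [alternantExponent_succ, alternantExponent_castSucc]
  have := la.rowLen_anti j (j + 1) (Nat.le_succ _)
  lia

theorem intCast_alternantExponent (la : YoungDiagram) (j : Fin n) :
    (alternantExponent la j : ℤ) = betaNumber la j + (n - 1) := by
  rw [alternantExponent, betaNumber, Fin.val_rev, Nat.cast_add, Nat.cast_sub j.2, Nat.cast_succ]
  ring

/-- The sets of exponents of the partitions `nu` of length at most `n` such that `la / nu` is a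
horizontal strip: the interlacing condition confines each exponent to an interval. -/
def interlacingExponents (la : YoungDiagram) (n : ℕ) : Finset (Fin n → ℕ) :=
  Fintype.piFinset fun j =>
    Finset.Ico (alternantExponent la j.succ) (alternantExponent la j.castSucc)

theorem mem_interlacingExponents {r : Fin n → ℕ} : r ∈ interlacingExponents la n ↔
    ∀ j : Fin n, la.rowLen (j + 1) + j.rev ≤ r j ∧ r j ≤ la.rowLen j + j.rev := by
  simp only [interlacingExponents, Fintype.mem_piFinset, Finset.mem_Ico, alternantExponent_succ,
    alternantExponent_castSucc, Nat.lt_succ_iff]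

theorem isHorizontalStrip_iff_alternantExponent_mem (hla : la.colLen 0 ≤ n + 1)
    (hnu : nu.colLen 0 ≤ n) :
    IsHorizontalStrip la nu ↔ (alternantExponent nu : Fin n → ℕ) ∈ interlacingExponents la n := by
  simp only [mem_interlacingExponents, alternantExponent, isHorizontalStrip_iff_rowLen,
    youngDiagram_le_iff_rowLen, add_le_add_iff_right, ← forall_and, Fin.forall_iff]
  refine forall_congr' fun i => ⟨fun h _ => h.symm, fun h => ?_⟩
  rcases lt_or_ge i n with hi | hi
  · exact (h hi).symm
  · simp only [colLen_zero_le_iff.1 hnu i hi, colLen_zero_le_iff.1 hla (i + 1) (by lia), zero_le,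
      le_refl, and_self]

theorem alternantExponent_injOn :
    Set.InjOn (fun nu : YoungDiagram => (alternantExponent nu : Fin n → ℕ))
      {nu | nu.colLen 0 ≤ n} :=
  fun _ hmu _ hnu h => youngDiagram_ext_rowLen hnu hmu fun i =>
    Nat.add_right_cancel (congrFun h i)

theorem exists_alternantExponent_eq {r : Fin n → ℕ} (hr : r ∈ interlacingExponents la n) :
    ∃ nu : YoungDiagram, nu.colLen 0 ≤ n ∧ alternantExponent nu = r := by
  rw [mem_interlacingExponents] at hr
  have hanti : Antitone fun i : Fin n => r i - i.rev := by
    refine antitone_iff_forall_lt.2 fun i j hij => ?_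
    have hi := (hr i).1
    have hj := (hr j).2
    have := la.rowLen_anti (i + 1) j hij
    lia
  obtain ⟨nu, hnu, hrow⟩ := exists_youngDiagram_rowLen_eq hanti
  refine ⟨nu, hnu, funext fun i => ?_⟩
  rw [alternantExponent, hrow, Nat.sub_add_cancel (le_trans (Nat.le_add_left _ _) (hr i).1)]

theorem pow_card_sdiff_cells_eq (hla : la.colLen 0 ≤ n + 1) (hnu : nu.colLen 0 ≤ n) (z : R) :
    z ^ (la.cells \ nu.cells).card = z ^ alternantExponent la (Fin.last n) *
      ∏ j : Fin n, z ^ (alternantExponent la j.castSucc - 1 - alternantExponent nu j) := by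
  rw [card_sdiff_cells_eq_sum_rowLen hla, Fin.sum_univ_castSucc, add_comm, pow_add,
    Finset.prod_pow_eq_pow_sum, alternantExponent, Fin.val_last, colLen_zero_le_iff.1 hnu n le_rfl,
    Fin.rev_last, Fin.val_zero, add_zero, tsub_zero]
  simp only [alternantExponent_castSucc, Nat.add_sub_cancel]
  simp only [alternantExponent, Nat.add_sub_add_right, Fin.val_castSucc]

open scoped Classical in
theorem sum_horizontalStrips_alternantExponent (hla : la.colLen 0 ≤ n + 1) (z : R)
    (F : (Fin n → ℕ) → R) :
    ∑ nu ∈ horizontalStrips la with nu.colLen 0 ≤ n,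
        z ^ (la.cells \ nu.cells).card * F (alternantExponent nu) =
      z ^ alternantExponent la (Fin.last n) * ∑ r ∈ interlacingExponents la n,
        (∏ j : Fin n, z ^ (alternantExponent la j.castSucc - 1 - r j)) * F r := by
  rw [Finset.mul_sum]
  refine Finset.sum_bij (fun nu _ => alternantExponent nu) ?_ ?_ ?_ ?_ <;>
    simp only [Finset.mem_filter, mem_horizontalStrips]
  · exact fun nu hnu => (isHorizontalStrip_iff_alternantExponent_mem hla hnu.2).1 hnu.1
  · exact fun mu hmu nu hnu h => alternantExponent_injOn hmu.2 hnu.2 h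
  · intro r hr
    obtain ⟨nu, hnu, rfl⟩ := exists_alternantExponent_eq hr
    exact ⟨nu, ⟨(isHorizontalStrip_iff_alternantExponent_mem hla hnu).2 hr, hnu⟩, rfl⟩
  · exact fun nu hnu => by rw [pow_card_sdiff_cells_eq hla hnu.2, mul_assoc]

theorem rowLen_bot (i : ℕ) : (⊥ : YoungDiagram).rowLen i = 0 :=
  Nat.eq_zero_of_not_pos fun h => notMem_bot _ (mem_iff_lt_rowLen.2 h)

theorem alternant_bot_succ (x : Fin (n + 1) → R) :
    alternant ⊥ x = (∏ i : Fin n, (x i.castSucc - x (Fin.last n))) *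
      alternant ⊥ fun i : Fin n => x i.castSucc := by
  rw [alternant, det_pow_succ x (alternantExponent_succ_le_castSucc ⊥)]
  simp only [alternantExponent_succ, alternantExponent_castSucc, rowLen_bot, zero_add,
    Nat.Ico_succ_singleton, Finset.sum_singleton, Nat.add_sub_cancel, Nat.sub_self, pow_zero,
    mul_one]
  simp only [alternant, alternantExponent, rowLen_bot, zero_add, Fin.rev_last, Fin.val_zero,
    pow_zero, mul_one]

theorem alternant_succ (hla : la.colLen 0 ≤ n + 1) (x : Fin (n + 1) → R) :
    open scoped Classical in
    alternant la x = (∏ i : Fin n, (x i.castSucc - x (Fin.last n))) *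
      ∑ nu ∈ horizontalStrips la with nu.colLen 0 ≤ n,
        x (Fin.last n) ^ (la.cells \ nu.cells).card *
          alternant nu fun i : Fin n => x i.castSucc := by
  rw [alternant, det_pow_succ x (alternantExponent_succ_le_castSucc la), mul_assoc,
    det_sum_mul _ (fun j p => x (Fin.last n) ^ (alternantExponent la j.castSucc - 1 - p))
      (fun p i => x i.castSucc ^ p)]
  exact congrArg _ (sum_horizontalStrips_alternantExponent hla (x (Fin.last n))
    fun r => Matrix.det (Matrix.of fun i j : Fin n => x i.castSucc ^ r j)).symm

/-- The determinants on both sides satisfy the same branching rule: by column operations and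
multilinearity, an alternant expands over the exponents interlacing its own. -/
theorem skewSchurEval_bot_mul_alternant_bot (x : Fin n → R) (hla : la.colLen 0 ≤ n) :
    skewSchurEval la ⊥ x * alternant ⊥ x = alternant la x := by
  induction n generalizing la with
  | zero =>
    obtain rfl : la = ⊥ := youngDiagram_ext_rowLen
      (not_lt.1 fun h => notMem_bot _ (mem_iff_lt_colLen.2 h)) hla fun i => i.elim0
    rw [skewSchurEval_self, one_mul]
  | succ n ih =>
    classical
    rw [alternant_bot_succ, alternant_succ hla, skewSchurEval_succ, mul_left_comm, Finset.sum_mul,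
      ← Finset.sum_filter_of_ne (p := fun nu => nu.colLen 0 ≤ n) fun nu _ hne => not_lt.1 fun hn =>
        hne (by rw [skewSchurEval_bot_of_lt_colLen _ hn, mul_zero, zero_mul])]
    refine congrArg _ (Finset.sum_congr rfl fun nu hnu => ?_)
    rw [mul_assoc, ih _ (Finset.mem_filter.1 hnu).2]

theorem alternant_bot_eq_sign_mul_det_vandermonde (x : Fin n → R) :
    alternant ⊥ x = Equiv.Perm.sign (Fin.revPerm (n := n)) * (Matrix.vandermonde x).det := by
  rw [← Matrix.det_permute', alternant]
  simp only [alternantExponent, rowLen_bot, zero_add]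
  rfl

end Bialternant

/-! ### Triangular Toeplitz matrices of binomial coefficients -/

section BinomialToeplitz

variable {R : Type*} [CommRing R] [BinomialRing R]

/-- The binomial coefficient of `x` and `a - r`, taken to be `0` if `a < r`: the entry `(a, r)` of
the Toeplitz matrix with symbol `(1 + z) ^ x`. -/
def chooseSub (x : R) (a r : ℕ) : R := if r ≤ a then Ring.choose x (a - r) else 0

theorem chooseSub_of_le (x : R) {a r : ℕ} (h : r ≤ a) :
    chooseSub x a r = Ring.choose x (a - r) := if_pos h

theorem chooseSub_of_lt (x : R) {a r : ℕ} (h : a < r) : chooseSub x a r = 0 := if_neg h.not_ge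

theorem chooseSub_zero_right (x : R) (a : ℕ) : chooseSub x a 0 = Ring.choose x a :=
  chooseSub_of_le x a.zero_le

theorem chooseSub_self (x : R) (a : ℕ) : chooseSub x a a = 1 := by
  rw [chooseSub_of_le x le_rfl, Nat.sub_self, Ring.choose_zero_right]

theorem chooseSub_zero_left (a r : ℕ) : chooseSub (0 : R) a r = if a = r then 1 else 0 := by
  rcases le_or_gt r a with h | h
  · rw [chooseSub_of_le _ h, Ring.choose_zero_ite]
    exact if_congr (by lia) rfl rfl
  · rw [chooseSub_of_lt _ h, if_neg h.ne]

theorem chooseSub_neg (x : R) {a r : ℕ} (h : r ≤ a) :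
    chooseSub (-x) a r = (-1) ^ (a + r) * Ring.choose (x + a - r - 1) (a - r) := by
  obtain ⟨m, rfl⟩ := Nat.exists_eq_add_of_le h
  have hsign : (-1 : R) ^ (r + m + r) = (-1) ^ m := by
    rw [add_right_comm, ← two_mul, pow_add, pow_mul, neg_one_sq, one_pow, one_mul]
  rw [chooseSub_of_le _ h, Nat.add_sub_cancel_left, Ring.choose_neg, hsign, Units.smul_def,
    Int.coe_negOnePow_natCast, zsmul_eq_mul]
  push_cast
  congr 2
  ring

theorem sum_chooseSub_mul_chooseSub (x y : R) {a n : ℕ} (ha : a < n) (k : ℕ) :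
    ∑ r ∈ Finset.range n, chooseSub x a r * chooseSub y r k = chooseSub (x + y) a k := by
  have hIco : ∑ r ∈ Finset.range n, chooseSub x a r * chooseSub y r k =
      ∑ r ∈ Finset.Ico k (a + 1), chooseSub x a r * chooseSub y r k := by
    refine (Finset.sum_subset (fun r hr => ?_) fun r _ hr => ?_).symm
    · exact Finset.mem_range.2 ((Finset.mem_Ico.1 hr).2.trans_le ha)
    · rcases lt_or_ge r k with hk | hk
      · rw [chooseSub_of_lt y hk, mul_zero]
      · rw [chooseSub_of_lt x (by grind), zero_mul]
  rw [hIco]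
  rcases lt_or_ge a k with h | h
  · rw [Finset.Ico_eq_empty_of_le h, Finset.sum_empty, chooseSub_of_lt _ h]
  rw [chooseSub_of_le _ h, add_comm x, Ring.add_choose_eq _ (Commute.all _ _),
    Finset.Nat.sum_antidiagonal_eq_sum_range_succ_mk, Finset.sum_Ico_eq_sum_range,
    Nat.sub_add_comm h]
  refine Finset.sum_congr rfl fun i hi => ?_
  have hi := Finset.mem_range.1 hi
  rw [chooseSub_of_le x (by lia), chooseSub_of_le y (by lia), Nat.add_sub_cancel_left,
    Nat.sub_sub, mul_comm]

theorem choose_natCast_mul_choose (x : R) (b i : ℕ) :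
    Ring.choose (b : R) i * Ring.choose x b = Ring.choose x i * chooseSub (x - i) b i := by
  rw [Ring.choose_natCast]
  rcases lt_or_ge b i with h | h
  · rw [Nat.choose_eq_zero_of_lt h, chooseSub_of_lt _ h, Nat.cast_zero, zero_mul, mul_zero]
  · rw [← nsmul_eq_mul, Ring.choose_smul_choose x h, chooseSub_of_le _ h]

theorem chooseSub_mul_chooseSub_sub (x : R) (a r i : ℕ) :
    chooseSub x a i * chooseSub (a - i : R) r i =
      chooseSub x a r * chooseSub (x - a + r) r i := by
  rcases lt_or_ge a i with hi | hi
  · rw [chooseSub_of_lt x hi, zero_mul]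
    rcases lt_or_ge a r with hr | hr
    · rw [chooseSub_of_lt x hr, zero_mul]
    · rw [chooseSub_of_lt _ (hr.trans_lt hi), mul_zero]
  rcases lt_or_ge r i with hr | hr
  · rw [chooseSub_of_lt _ hr, chooseSub_of_lt _ hr, mul_zero, mul_zero]
  obtain ⟨m, rfl⟩ := Nat.exists_eq_add_of_le hi
  obtain ⟨l, rfl⟩ := Nat.exists_eq_add_of_le hr
  rw [chooseSub_of_le _ hi, chooseSub_of_le _ hr, chooseSub_of_le _ hr, Nat.add_sub_cancel_left,
    Nat.add_sub_cancel_left, Nat.cast_add, add_sub_cancel_left, Ring.choose_natCast, mul_comm]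
  rcases lt_or_ge m l with hl | hl
  · rw [Nat.choose_eq_zero_of_lt hl, chooseSub_of_lt _ (by lia), Nat.cast_zero, zero_mul, zero_mul]
  · rw [← nsmul_eq_mul, chooseSub_of_le _ (by lia), ← Nat.choose_symm hl,
      Ring.choose_smul_choose x (Nat.sub_le m l), Nat.sub_sub_self hl, Nat.add_sub_add_left,
      Nat.cast_sub hl]
    congr 2
    push_cast
    ring

/-- Expand both factors on the right by the Chu–Vandermonde identity; trinomial revision turns the
inner sum over `i` on the left into one more Chu–Vandermonde sum. -/
theorem sum_chooseSub_mul_chooseSub_mul_choose (x y : R) {a b n : ℕ} (ha : a < n) (hb : b < n) :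
    ∑ r ∈ Finset.range n, chooseSub x a r * chooseSub y b r * Ring.choose (x + y + r) r =
      Ring.choose (x + b) a * Ring.choose (y + a) b := by
  have hinner : ∀ r < n, Ring.choose (x + y + r) r =
      ∑ i ∈ Finset.range n, chooseSub (x - a + r) r i * Ring.choose (y + a) i := fun r hr => by
    have h := sum_chooseSub_mul_chooseSub (x - a + r) (y + a) hr 0
    simp only [chooseSub_zero_right] at h
    rw [h]
    congr 1
    ring
  calc ∑ r ∈ Finset.range n, chooseSub x a r * chooseSub y b r * Ring.choose (x + y + r) r
    _ = ∑ r ∈ Finset.range n, ∑ i ∈ Finset.range n, chooseSub x a i * Ring.choose (y + a) i *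
          (chooseSub y b r * chooseSub (a - i : R) r i) := by
        refine Finset.sum_congr rfl fun r hr => ?_
        rw [hinner r (Finset.mem_range.1 hr), Finset.mul_sum]
        refine Finset.sum_congr rfl fun i _ => ?_
        linear_combination -(chooseSub y b r * Ring.choose (y + a) i) *
          chooseSub_mul_chooseSub_sub x a r i
    _ = ∑ i ∈ Finset.range n,
          chooseSub x a i * (Ring.choose (b : R) i * Ring.choose (y + a) b) := by
        rw [Finset.sum_comm]
        refine Finset.sum_congr rfl fun i _ => ?_
        rw [← Finset.mul_sum, sum_chooseSub_mul_chooseSub _ _ hb, choose_natCast_mul_choose,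
          add_sub_assoc, mul_assoc]
    _ = Ring.choose (x + b) a * Ring.choose (y + a) b := by
        have h := sum_chooseSub_mul_chooseSub x (b : R) ha 0
        simp only [chooseSub_zero_right] at h
        simp only [← h, Finset.sum_mul, mul_assoc]

/-- The lower triangular Toeplitz matrix with symbol `(1 + z) ^ x`. -/
def binomialToeplitz (x : R) (n : ℕ) : Matrix (Fin n) (Fin n) R :=
  Matrix.of fun a r => chooseSub x a r

theorem binomialToeplitz_mul (x y : R) (n : ℕ) :
    binomialToeplitz x n * binomialToeplitz y n = binomialToeplitz (x + y) n := by
  ext a k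
  simp only [binomialToeplitz, Matrix.mul_apply, Matrix.of_apply,
    ← sum_chooseSub_mul_chooseSub x y a.2 k, Finset.sum_range]

theorem binomialToeplitz_zero (n : ℕ) : binomialToeplitz (0 : R) n = 1 := by
  ext a k
  simp only [binomialToeplitz, Matrix.of_apply, chooseSub_zero_left, Matrix.one_apply, Fin.ext_iff]

theorem binomialToeplitz_mul_neg (x : R) (n : ℕ) :
    binomialToeplitz x n * binomialToeplitz (-x) n = 1 := by
  rw [binomialToeplitz_mul, add_neg_cancel, binomialToeplitz_zero]

theorem det_binomialToeplitz (x : R) (n : ℕ) : (binomialToeplitz x n).det = 1 := by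
  rw [Matrix.det_of_isLowerTriangular (binomialToeplitz x n) fun a r h => chooseSub_of_lt x h]
  exact Finset.prod_eq_one fun r _ => chooseSub_self x r

end BinomialToeplitz

/-! ### The Toeplitz matrix of a pure Fisher–Hartwig symbol -/

noncomputable section FisherHartwigMatrix

theorem inv_Gamma_eq_self_mul_inv_Gamma_add_one (x : ℝ) :
    (Real.Gamma x)⁻¹ = x * (Real.Gamma (x + 1))⁻¹ := by
  rcases eq_or_ne x 0 with rfl | hx
  · rw [Real.Gamma_zero, inv_zero, zero_mul]
  · rw [Real.Gamma_add_one hx, mul_inv, mul_inv_cancel_left₀ hx]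

theorem choose_eq_Gamma_div {x : ℝ} (hx : Real.Gamma (x + 1) ≠ 0) (n : ℕ) :
    Ring.choose x n = Real.Gamma (x + 1) / (n.factorial * Real.Gamma (x - n + 1)) := by
  induction n with
  | zero => simp [hx]
  | succ n ih =>
    have hsucc := Ring.choose_smul_choose x (Nat.le_succ n)
    rw [Nat.succ_sub (le_refl n), Nat.sub_self, Ring.choose_one_right, nsmul_eq_mul,
      Nat.choose_succ_self_right, ih] at hsucc
    refine mul_left_cancel₀ (Nat.cast_ne_zero.2 n.succ_ne_zero) (hsucc.trans ?_)
    rw [Nat.factorial_succ, Nat.cast_mul, div_eq_mul_inv, div_eq_mul_inv, mul_inv, mul_inv,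
      Nat.cast_succ, ← sub_sub, sub_add_cancel, inv_Gamma_eq_self_mul_inv_Gamma_add_one (x - n)]
    have : (n : ℝ) + 1 ≠ 0 := by positivity
    field_simp

/-- The Fourier coefficients of the pure Fisher–Hartwig symbol with parameters `g` and `d`. -/
def fhCoeff (g d : ℝ) (n : ℤ) : ℝ :=
  Real.Gamma (g + d + 1) / (Real.Gamma (g - n + 1) * Real.Gamma (d + n + 1))

/-- The quotient `Γ(x + r + 1) / Γ(r + 1)`, which scales the rows and columns of the triangular
factors of a Fisher–Hartwig Toeplitz matrix. -/
def gammaRatio (x : ℝ) (r : ℕ) : ℝ := Real.Gamma (x + r + 1) / Real.Gamma (r + 1)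

theorem gammaRatio_pos {x : ℝ} (hx : -1 < x) (r : ℕ) : 0 < gammaRatio x r :=
  div_pos (Real.Gamma_pos_of_pos (by linarith [r.cast_nonneg (α := ℝ)]))
    (Real.Gamma_pos_of_pos (by positivity))

variable {g d : ℝ} {n : ℕ}

theorem fhCoeff_natCast_sub_natCast (hg : -1 < g) (hd : -1 < d) (hgd : -1 < g + d) {a b : ℕ}
    (ha : a < n) (hb : b < n) :
    fhCoeff g d (a - b) = (gammaRatio d a)⁻¹ *
      (∑ r ∈ Finset.range n, chooseSub g a r * gammaRatio (g + d) r * chooseSub d b r) *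
      (gammaRatio g b)⁻¹ := by
  have hΓ : ∀ {x : ℝ}, -1 < x → ∀ r : ℕ, Real.Gamma (x + r + 1) ≠ 0 := fun hx r =>
    (Real.Gamma_pos_of_pos (by linarith [r.cast_nonneg (α := ℝ)])).ne'
  have hΓ0 : Real.Gamma (g + d + 1) ≠ 0 := (Real.Gamma_pos_of_pos (by linarith)).ne'
  have hfactorial : ∀ r : ℕ, (r.factorial : ℝ) ≠ 0 := fun r =>
    Nat.cast_ne_zero.2 r.factorial_ne_zero
  have hsum : ∑ r ∈ Finset.range n, chooseSub g a r * gammaRatio (g + d) r * chooseSub d b r =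
      Real.Gamma (g + d + 1) * (Ring.choose (g + b) a * Ring.choose (d + a) b) := by
    rw [← sum_chooseSub_mul_chooseSub_mul_choose g d ha hb, Finset.mul_sum]
    refine Finset.sum_congr rfl fun r _ => ?_
    rw [choose_eq_Gamma_div (hΓ hgd r), add_sub_cancel_right, gammaRatio,
      Real.Gamma_nat_eq_factorial]
    field_simp
  rw [hsum, choose_eq_Gamma_div (hΓ hg b), choose_eq_Gamma_div (hΓ hd a), fhCoeff, gammaRatio,
    gammaRatio, Real.Gamma_nat_eq_factorial, Real.Gamma_nat_eq_factorial, Int.cast_sub,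
    Int.cast_natCast, Int.cast_natCast, ← sub_add, add_sub_right_comm, ← add_sub_assoc]
  have := hΓ hg b
  have := hΓ hd a
  have := hfactorial a
  have := hfactorial b
  field_simp

/-- The Toeplitz matrix of the pure Fisher–Hartwig symbol. -/
def fhMatrix (g d : ℝ) (n : ℕ) : Matrix (Fin n) (Fin n) ℝ :=
  Matrix.of fun a b => fhCoeff g d (a - b)

/-- The inverse of `fhMatrix g d n`, as a product of triangular matrices. -/
def fhMatrixInv (g d : ℝ) (n : ℕ) : Matrix (Fin n) (Fin n) ℝ :=
  Matrix.diagonal (fun j : Fin n => gammaRatio g j) * (binomialToeplitz (-d) n).transpose *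
    Matrix.diagonal (fun r : Fin n => (gammaRatio (g + d) r)⁻¹) * binomialToeplitz (-g) n *
    Matrix.diagonal (fun k : Fin n => gammaRatio d k)

theorem fhMatrix_eq_mul (hg : -1 < g) (hd : -1 < d) (hgd : -1 < g + d) : fhMatrix g d n =
    Matrix.diagonal (fun a : Fin n => (gammaRatio d a)⁻¹) * binomialToeplitz g n *
      Matrix.diagonal (fun r : Fin n => gammaRatio (g + d) r) *
      (binomialToeplitz d n).transpose * Matrix.diagonal (fun b : Fin n => (gammaRatio g b)⁻¹) := by
  ext a b
  rw [fhMatrix, Matrix.of_apply, fhCoeff_natCast_sub_natCast hg hd hgd a.2 b.2, Finset.sum_range,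
    Matrix.mul_diagonal, Matrix.mul_apply, Finset.mul_sum]
  simp only [Matrix.mul_diagonal, Matrix.diagonal_mul, Matrix.transpose_apply, binomialToeplitz,
    Matrix.of_apply, mul_assoc]

theorem det_fhMatrix (hg : -1 < g) (hd : -1 < d) (hgd : -1 < g + d) : (fhMatrix g d n).det =
    ∏ r ∈ Finset.range n, gammaRatio (g + d) r / (gammaRatio g r * gammaRatio d r) := by
  simp only [fhMatrix_eq_mul hg hd hgd, Matrix.det_mul, Matrix.det_diagonal, Matrix.det_transpose,
    det_binomialToeplitz, mul_one, Finset.prod_range, ← Finset.prod_mul_distrib]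
  exact Finset.prod_congr rfl fun r _ => by rw [div_eq_mul_inv, mul_inv]; ring

theorem fhMatrix_mul_fhMatrixInv (hg : -1 < g) (hd : -1 < d) (hgd : -1 < g + d) :
    fhMatrix g d n * fhMatrixInv g d n = 1 := by
  have hdiag : ∀ {u v : Fin n → ℝ}, (∀ r, u r * v r = 1) → ∀ A : Matrix (Fin n) (Fin n) ℝ,
      Matrix.diagonal u * (Matrix.diagonal v * A) = A := fun huv A => by
    rw [← Matrix.mul_assoc, Matrix.diagonal_mul_diagonal, funext huv, Matrix.diagonal_one,
      Matrix.one_mul]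
  have hd' := fun r : Fin n => inv_mul_cancel₀ (gammaRatio_pos hd r).ne'
  have hg' := fun r : Fin n => inv_mul_cancel₀ (gammaRatio_pos hg r).ne'
  have hgd' := fun r : Fin n => mul_inv_cancel₀ (gammaRatio_pos hgd r).ne'
  have htoeplitz : (binomialToeplitz d n).transpose * (binomialToeplitz (-d) n).transpose = 1 := by
    rw [← Matrix.transpose_mul, binomialToeplitz_mul, neg_add_cancel, binomialToeplitz_zero,
      Matrix.transpose_one]
  simp only [fhMatrix_eq_mul hg hd hgd, fhMatrixInv, Matrix.mul_assoc, hdiag hg']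
  rw [← Matrix.mul_assoc (binomialToeplitz d n).transpose, htoeplitz, Matrix.one_mul, hdiag hgd',
    ← Matrix.mul_assoc (binomialToeplitz g n), binomialToeplitz_mul_neg, Matrix.one_mul,
    Matrix.diagonal_mul_diagonal, funext hd', Matrix.diagonal_one]

theorem fhMatrixInv_apply (g d : ℝ) (N : ℕ) (j k : Fin (N + 1)) :
    fhMatrixInv g d (N + 1) j k = (-1) ^ (k + j : ℕ) * (gammaRatio g j * gammaRatio d k *
      ∑ r ∈ Finset.Icc (max (j : ℕ) k) N, (gammaRatio (g + d) r)⁻¹ *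
        Ring.choose (g + r - k - 1) (r - k) * Ring.choose (d + r - j - 1) (r - j)) := by
  have hsum : fhMatrixInv g d (N + 1) j k = gammaRatio g j * gammaRatio d k *
      ∑ r ∈ Finset.range (N + 1), chooseSub (-d) r j * (gammaRatio (g + d) r)⁻¹ *
        chooseSub (-g) r k := by
    rw [fhMatrixInv, Matrix.mul_diagonal, Matrix.mul_apply, Finset.sum_range, mul_right_comm,
      Finset.mul_sum]
    simp only [Matrix.mul_diagonal, Matrix.diagonal_mul, Matrix.transpose_apply, binomialToeplitz,
      Matrix.of_apply, mul_assoc]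
  have hsubset : Finset.Icc (max (j : ℕ) k) N ⊆ Finset.range (N + 1) := fun r hr =>
    Finset.mem_range_succ_iff.2 (Finset.mem_Icc.1 hr).2
  rw [hsum, mul_left_comm, ← Finset.sum_subset hsubset fun r hr hr' => ?_]
  · refine congrArg _ ((Finset.sum_congr rfl fun r hr => ?_).trans (Finset.mul_sum ..).symm)
    have hr := Finset.mem_Icc.1 hr
    have hsign : (-1 : ℝ) ^ (r + j : ℕ) * (-1) ^ (r + k : ℕ) = (-1) ^ (k + j : ℕ) := by
      rw [← pow_add, add_add_add_comm, ← two_mul, pow_add, pow_mul, neg_one_sq, one_pow, one_mul,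
        add_comm]
    rw [chooseSub_neg d (by lia), chooseSub_neg g (by lia), ← hsign]
    ring
  · rw [Finset.mem_range] at hr
    rw [Finset.mem_Icc] at hr'
    rcases lt_or_ge r j with h | h
    · rw [chooseSub_of_lt _ h, zero_mul, zero_mul]
    · rw [chooseSub_of_lt _ (show r < k by lia), mul_zero]

theorem det_submatrix_succAbove_of_mul_eq_one {R : Type*} [CommRing R]
    {A B : Matrix (Fin (n + 1)) (Fin (n + 1)) R} (h : A * B = 1) (j k : Fin (n + 1)) :
    (A.submatrix k.succAbove j.succAbove).det = (-1) ^ (k + j : ℕ) * (A.det * B j k) := by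
  have hadjugate : A.adjugate = A.det • B := by
    rw [← Matrix.mul_one A.adjugate, ← h, ← Matrix.mul_assoc, Matrix.adjugate_mul,
      Matrix.smul_mul, Matrix.one_mul]
  have hminor := Matrix.adjugate_fin_succ_eq_det_submatrix A j k
  rw [hadjugate, Matrix.smul_apply, smul_eq_mul] at hminor
  rw [hminor, ← mul_assoc, ← pow_add, ← two_mul, pow_mul, neg_one_sq, one_pow, one_mul]

/-- By Jacobi's complementary minor formula, a minor omitting one row and one column is an entry of
the inverse matrix up to the determinant. -/
theorem det_fhMatrix_submatrix_succAbove (hg : -1 < g) (hd : -1 < d) (hgd : -1 < g + d) {N : ℕ}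
    (j k : Fin (N + 1)) :
    ((fhMatrix g d (N + 1)).submatrix k.succAbove j.succAbove).det =
      (∏ r ∈ Finset.range (N + 1), gammaRatio (g + d) r / (gammaRatio g r * gammaRatio d r)) *
      (gammaRatio g j * gammaRatio d k * ∑ r ∈ Finset.Icc (max (j : ℕ) k) N,
        (gammaRatio (g + d) r)⁻¹ * Ring.choose (g + r - k - 1) (r - k) *
          Ring.choose (d + r - j - 1) (r - j)) := by
  rw [det_submatrix_succAbove_of_mul_eq_one (fhMatrix_mul_fhMatrixInv hg hd hgd),
    fhMatrixInv_apply, det_fhMatrix hg hd hgd, mul_left_comm, ← mul_assoc ((-1) ^ _), ← pow_add,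
    ← two_mul, pow_mul, neg_one_sq, one_pow, one_mul]

end FisherHartwigMatrix

/-! ### The Barnes function -/

section Barnes

open Filter Topology

variable {x z : ℝ}

/-- The `n`-th factor, with `n` starting from `0`, of the Weierstrass product of the Barnes function
at `z + 1`. -/
noncomputable def barnesFactor (z : ℝ) (n : ℕ) : ℝ :=
  (1 + z / (n + 1)) ^ (n + 1) * Real.exp (z ^ 2 / (2 * (n + 1)) - z)

/-- The factor in front of the Weierstrass product of the Barnes function at `z + 1`. -/
noncomputable def barnesPrefactor (z : ℝ) : ℝ :=
  (2 * π) ^ (z / 2) * Real.exp (-(z + z ^ 2 * (1 + Real.eulerMascheroniConstant)) / 2)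

theorem barnesG_add_one_eq_mul_tprod (z : ℝ) :
    barnesG (z + 1) = barnesPrefactor z * ∏' n, barnesFactor z n := by
  simp only [barnesG, barnesPrefactor, barnesFactor, add_sub_cancel_right]

theorem barnesG_one : barnesG 1 = 1 := by
  rw [← zero_add (1 : ℝ), barnesG_add_one_eq_mul_tprod]
  simp [barnesPrefactor, barnesFactor]

theorem barnesPrefactor_pos (z : ℝ) : 0 < barnesPrefactor z := by
  unfold barnesPrefactor
  positivity

theorem one_add_div_natCast_add_one_pos (hz : -1 < z) (n : ℕ) : 0 < 1 + z / ((n : ℝ) + 1) := by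
  have hn : (0 : ℝ) < n + 1 := n.cast_add_one_pos
  have hlt : -1 < z / ((n : ℝ) + 1) := by
    rw [lt_div_iff₀ hn]
    linarith [n.cast_nonneg (α := ℝ)]
  linarith

theorem barnesFactor_pos (hz : -1 < z) (n : ℕ) : 0 < barnesFactor z n :=
  mul_pos (pow_pos (one_add_div_natCast_add_one_pos hz n) _) (Real.exp_pos _)

theorem log_barnesFactor (hz : -1 < z) (n : ℕ) : Real.log (barnesFactor z n) =
    (n + 1) * (Real.log (1 + z / (n + 1)) - (z / (n + 1) - (z / (n + 1)) ^ 2 / 2)) := by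
  rw [barnesFactor, Real.log_mul (pow_pos (one_add_div_natCast_add_one_pos hz n) _).ne'
    (Real.exp_pos _).ne', Real.log_exp, Real.log_pow]
  push_cast
  field_simp
  ring

theorem abs_log_one_add_sub_le {u : ℝ} (hu : |u| ≤ 1 / 2) :
    |Real.log (1 + u) - (u - u ^ 2 / 2)| ≤ 2 * |u| ^ 3 := by
  have htaylor := Real.abs_log_sub_add_sum_range_le (x := -u) (by rw [abs_neg]; linarith) 2
  rw [abs_neg, Finset.sum_range_succ, Finset.sum_range_one, sub_neg_eq_add] at htaylor
  have hcube : |u| ^ (2 + 1) / (1 - |u|) ≤ 2 * |u| ^ 3 := by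
    rw [div_le_iff₀ (by linarith)]
    linear_combination
      mul_nonneg (pow_nonneg (abs_nonneg u) 3) (show 0 ≤ 1 - 2 * |u| by linarith)
  refine le_trans (le_of_eq (congrArg _ ?_)) (htaylor.trans hcube)
  push_cast
  ring

theorem abs_log_barnesFactor_le (hz : -1 < z) {n : ℕ} (hn : 2 * |z| ≤ n + 1) :
    |Real.log (barnesFactor z n)| ≤ 2 * |z| ^ 3 * (1 / ((n : ℝ) + 1) ^ 2) := by
  have hn0 : (0 : ℝ) < n + 1 := n.cast_add_one_pos
  have habs : |z / ((n : ℝ) + 1)| = |z| / (n + 1) := by rw [abs_div, abs_of_pos hn0]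
  rw [log_barnesFactor hz, abs_mul, abs_of_pos hn0]
  calc ((n : ℝ) + 1) * |_| ≤ ((n : ℝ) + 1) * (2 * |z / ((n : ℝ) + 1)| ^ 3) := by
        refine mul_le_mul_of_nonneg_left (abs_log_one_add_sub_le ?_) hn0.le
        rw [habs, div_le_iff₀ hn0]
        linarith
    _ = 2 * |z| ^ 3 * (1 / ((n : ℝ) + 1) ^ 2) := by
        rw [habs]
        field_simp

theorem summable_log_barnesFactor (hz : -1 < z) :
    Summable fun n => Real.log (barnesFactor z n) := by
  have hsq : Summable fun n : ℕ => 2 * |z| ^ 3 * (1 / ((n : ℝ) + 1) ^ 2) := by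
    simpa only [Nat.cast_add, Nat.cast_one] using
      ((summable_nat_add_iff 1).2 (Real.summable_one_div_nat_pow.2 one_lt_two)).mul_left _
  refine Summable.of_norm_bounded_eventually_nat hsq ?_
  obtain ⟨n₀, hn₀⟩ := exists_nat_ge (2 * |z|)
  filter_upwards [eventually_ge_atTop n₀] with n hn
  have hcast : (n₀ : ℝ) ≤ n := Nat.cast_le.2 hn
  exact abs_log_barnesFactor_le hz (by linarith)

theorem barnesG_pos (hx : 0 < x) : 0 < barnesG x := by
  have hz : -1 < x - 1 := by linarith
  rw [← sub_add_cancel x 1, barnesG_add_one_eq_mul_tprod,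
    ← Real.rexp_tsum_eq_tprod (barnesFactor_pos hz) (summable_log_barnesFactor hz)]
  exact mul_pos (barnesPrefactor_pos _) (Real.exp_pos _)

theorem tendsto_prod_barnesFactor (hz : -1 < z) :
    Tendsto (fun n => barnesPrefactor z * ∏ k ∈ Finset.range n, barnesFactor z k) atTop
      (𝓝 (barnesG (z + 1))) := by
  rw [barnesG_add_one_eq_mul_tprod]
  exact (Real.multipliable_of_summable_log (barnesFactor_pos hz)
    (summable_log_barnesFactor hz)).hasProd.tendsto_prod_nat.const_mul _

theorem barnesFactor_mul_add_natCast (x : ℝ) (n : ℕ) :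
    barnesFactor x n * (x + n) * (n + x) ^ n =
      barnesFactor (x - 1) n * (n + 1 + x) ^ (n + 1) *
        Real.exp ((x - 1 / 2) * (n + 1 : ℝ)⁻¹ - 1) := by
  have hn0 : (n : ℝ) + 1 ≠ 0 := by positivity
  rw [barnesFactor, barnesFactor,
    show x ^ 2 / (2 * ((n : ℝ) + 1)) - x = ((x - 1) ^ 2 / (2 * (n + 1)) - (x - 1)) +
      ((x - 1 / 2) * (n + 1 : ℝ)⁻¹ - 1) by field_simp; ring, Real.exp_add,
    show 1 + x / ((n : ℝ) + 1) = (n + 1 + x) / (n + 1) by field_simp,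
    show 1 + (x - 1) / ((n : ℝ) + 1) = (n + x) / (n + 1) by field_simp; ring,
    div_pow, div_pow]
  ring

theorem prod_barnesFactor_mul_prod (x : ℝ) (n : ℕ) :
    (∏ k ∈ Finset.range n, barnesFactor x k) * ∏ j ∈ Finset.range n, (x + j) =
      (∏ k ∈ Finset.range n, barnesFactor (x - 1) k) *
        ((n + x) ^ n * Real.exp ((x - 1 / 2) * harmonic n - n)) := by
  induction n with
  | zero => simp
  | succ n ih =>
    have hexp : Real.exp ((x - 1 / 2) * harmonic (n + 1) - (n + 1 : ℕ)) =
        Real.exp ((x - 1 / 2) * harmonic n - n) *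
          Real.exp ((x - 1 / 2) * (n + 1 : ℝ)⁻¹ - 1) := by
      rw [← Real.exp_add, harmonic_succ]
      push_cast
      ring_nf
    rw [Finset.prod_range_succ, Finset.prod_range_succ, Finset.prod_range_succ, hexp,
      mul_mul_mul_comm, ih, Nat.cast_succ]
    linear_combination (∏ k ∈ Finset.range n, barnesFactor (x - 1) k) *
      Real.exp ((x - 1 / 2) * harmonic n - n) * barnesFactor_mul_add_natCast x n

theorem gammaSeq_mul_prod (hx : 0 < x) (n : ℕ) :
    Real.GammaSeq x n * ∏ j ∈ Finset.range n, (x + j) = (n : ℝ) ^ x * n.factorial / (n + x) := by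
  have hprod : ∏ j ∈ Finset.range n, (x + j) ≠ 0 :=
    Finset.prod_ne_zero_iff.2 fun j _ => by positivity
  rw [Real.GammaSeq, Finset.prod_range_succ, add_comm x n]
  field_simp

theorem exp_mul_harmonic_sub_log (x : ℝ) {n : ℕ} (hn : n ≠ 0) :
    Real.exp ((x - 1 / 2) * (harmonic n - Real.log n)) =
      Real.exp ((x - 1 / 2) * harmonic n) * (√n / (n : ℝ) ^ x) := by
  have hn0 : (0 : ℝ) < n := Nat.cast_pos.2 hn.pos
  rw [Real.sqrt_eq_rpow, ← Real.rpow_sub hn0, Real.rpow_def_of_pos hn0, ← Real.exp_add]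
  ring_nf

theorem inv_stirlingSeq_mul_sqrt_two (n : ℕ) :
    (Stirling.stirlingSeq n * √2)⁻¹ = √n * (n : ℝ) ^ n / (Real.exp n * n.factorial) := by
  rw [Stirling.stirlingSeq, Real.sqrt_mul zero_le_two, div_pow, ← Real.exp_nat_mul, mul_one]
  field_simp

/-- Each factor of the ratio has a known limit. -/
theorem prod_barnesFactor_eq_mul_prod_sub_one (hx : 0 < x) {n : ℕ} (hn : n ≠ 0) :
    ∏ k ∈ Finset.range n, barnesFactor x k =
      (∏ k ∈ Finset.range n, barnesFactor (x - 1) k) *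
        (Real.GammaSeq x n * (1 + x / n) ^ n * (1 + x / n) *
          Real.exp ((x - 1 / 2) * (harmonic n - Real.log n)) *
          (Stirling.stirlingSeq n * √2)⁻¹) := by
  have hn0 : (0 : ℝ) < n := Nat.cast_pos.2 hn.pos
  have hprod : 0 < ∏ j ∈ Finset.range n, (x + j) := Finset.prod_pos fun j _ => by positivity
  refine mul_right_cancel₀ hprod.ne' ?_
  rw [prod_barnesFactor_mul_prod, mul_assoc]
  refine congrArg _ (Eq.symm ?_)
  calc _ = Real.GammaSeq x n * (∏ j ∈ Finset.range n, (x + j)) * (1 + x / n) ^ n * (1 + x / n) *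
          Real.exp ((x - 1 / 2) * (harmonic n - Real.log n)) * (Stirling.stirlingSeq n * √2)⁻¹ := by
        ring
    _ = (n : ℝ) ^ x * n.factorial / (n + x) * ((n + x) / n) ^ n * ((n + x) / n) *
          (Real.exp ((x - 1 / 2) * harmonic n) * (√n / (n : ℝ) ^ x)) *
          (√n * (n : ℝ) ^ n / (Real.exp n * n.factorial)) := by
        rw [gammaSeq_mul_prod hx, exp_mul_harmonic_sub_log x hn, inv_stirlingSeq_mul_sqrt_two,
          one_add_div hn0.ne']
    _ = _ := by
        have hrpow : (n : ℝ) ^ x ≠ 0 := (Real.rpow_pos_of_pos hn0 x).ne'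
        rw [Real.exp_sub, div_pow]
        field_simp
        rw [Real.sq_sqrt hn0.le]

theorem tendsto_prod_barnesFactor_ratio (x : ℝ) :
    Tendsto (fun n : ℕ => Real.GammaSeq x n * (1 + x / n) ^ n * (1 + x / n) *
          Real.exp ((x - 1 / 2) * (harmonic n - Real.log n)) *
          (Stirling.stirlingSeq n * √2)⁻¹) atTop
      (𝓝 (Real.Gamma x * Real.exp x * 1 *
        Real.exp ((x - 1 / 2) * Real.eulerMascheroniConstant) * (√π * √2)⁻¹)) := by
  refine ((((Real.GammaSeq_tendsto_Gamma x).mul (Real.tendsto_one_add_div_pow_exp x)).mul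
    ?_).mul ?_).mul ?_
  · simpa only [add_zero] using (tendsto_const_div_atTop_nhds_zero_nat x).const_add 1
  · exact (Real.continuous_exp.tendsto _).comp (Real.tendsto_harmonic_sub_log.const_mul _)
  · exact (Stirling.tendsto_stirlingSeq_sqrt_pi.mul_const _).inv₀ (by positivity)

theorem barnesPrefactor_div_sub_one (x : ℝ) :
    barnesPrefactor x / barnesPrefactor (x - 1) =
      √π * √2 / (Real.exp x * Real.exp ((x - 1 / 2) * Real.eulerMascheroniConstant)) := by
  rw [div_eq_div_iff (barnesPrefactor_pos _).ne' (by positivity), barnesPrefactor,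
    barnesPrefactor, mul_assoc, ← Real.exp_add, ← Real.exp_add,
    show x / 2 = 1 / 2 + (x - 1) / 2 by ring, Real.rpow_add (by positivity), ← Real.sqrt_eq_rpow,
    Real.sqrt_mul zero_le_two]
  ring_nf

theorem barnesG_add_one (hx : 0 < x) : barnesG (x + 1) = Real.Gamma x * barnesG x := by
  have hsub := tendsto_prod_barnesFactor (z := x - 1) (by linarith)
  rw [sub_add_cancel] at hsub
  have hlim := (hsub.mul (tendsto_prod_barnesFactor_ratio x)).const_mul
    (barnesPrefactor x / barnesPrefactor (x - 1))
  rw [tendsto_nhds_unique ((tendsto_prod_barnesFactor (by linarith)).congr' ?_) hlim]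
  · rw [barnesPrefactor_div_sub_one]
    field_simp
  · filter_upwards [eventually_ne_atTop 0] with n hn
    have hprefactor := (barnesPrefactor_pos (x - 1)).ne'
    rw [prod_barnesFactor_eq_mul_prod_sub_one hx hn]
    field_simp

theorem barnesG_add_natCast (hx : 0 < x) (n : ℕ) :
    barnesG (x + n) = (∏ i ∈ Finset.range n, Real.Gamma (x + i)) * barnesG x := by
  induction n with
  | zero => simp
  | succ n ih =>
    rw [Finset.prod_range_succ, Nat.cast_succ, ← add_assoc, barnesG_add_one (by positivity), ih]
    ring

theorem barnesG_div_barnesG (hx : -1 < x) (N : ℕ) :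
    barnesG (x + N + 2) / barnesG (x + 1) =
      ∏ r ∈ Finset.range (N + 1), Real.Gamma (x + r + 1) := by
  have hx' : 0 < x + 1 := by linarith
  rw [show x + N + 2 = x + 1 + (N + 1 : ℕ) by push_cast; ring, barnesG_add_natCast hx',
    mul_div_cancel_right₀ _ (barnesG_pos hx').ne']
  simp only [add_right_comm]

theorem explicitValue_eq {g d : ℝ} (hg : -1 < g) (hd : -1 < d) (hgd : -1 < g + d) (N j k : ℕ) :
    explicitValue N j k (g + d) d =
      (∏ r ∈ Finset.range (N + 1), gammaRatio (g + d) r / (gammaRatio g r * gammaRatio d r)) *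
        (gammaRatio g j * gammaRatio d k *
          ∑ r ∈ Finset.Icc (max j k) N, (gammaRatio (g + d) r)⁻¹ *
            Ring.choose (g + r - k - 1) (r - k) * Ring.choose (d + r - j - 1) (r - j)) := by
  have hfactorial : barnesG (N + 2) = ∏ r ∈ Finset.range (N + 1), Real.Gamma (r + 1) := by
    simpa only [zero_add, barnesG_one, div_one] using barnesG_div_barnesG neg_one_lt_zero N
  have hGamma : ∏ r ∈ Finset.range (N + 1), Real.Gamma ((r : ℝ) + 1) ≠ 0 :=
    Finset.prod_ne_zero_iff.2 fun r _ => (Real.Gamma_pos_of_pos r.cast_add_one_pos).ne'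
  rw [explicitValue, add_sub_cancel_right, hfactorial, barnesG_div_barnesG hgd,
    ← inv_div (barnesG (g + N + 2)), barnesG_div_barnesG hg, ← inv_div (barnesG (d + N + 2)),
    barnesG_div_barnesG hd]
  simp only [gammaRatio, Finset.prod_div_distrib, Finset.prod_mul_distrib, inv_div]
  field_simp

end Barnes

/-! ### The Fourier coefficients of the pure Fisher–Hartwig symbol -/

section FisherHartwigIntegral

open Filter Topology MeasureTheory

variable {a b θ : ℝ}

/-- The function `e^{iθ(a-b)/2} (2 cos (θ/2))^{a+b}`, which for `|θ| < π` is the pure Fisher–Hartwig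
symbol `(1 + z)^a (1 + z⁻¹)^b` at `z = e^{iθ}`. -/
noncomputable def fhWeight (a b θ : ℝ) : ℂ :=
  Complex.exp (((a - b) / 2 * θ : ℝ) * Complex.I) * (((2 * Real.cos (θ / 2)) ^ (a + b) : ℝ) : ℂ)

/-- The integral of the pure Fisher–Hartwig symbol with parameters `a` and `b` over the circle. -/
noncomputable def fhIntegral (a b : ℝ) : ℂ := ∫ θ in (-π)..π, fhWeight a b θ

/-- The generalized binomial coefficient `binom(a + b, a)`. -/
noncomputable def gammaBinom (a b : ℝ) : ℝ :=
  Real.Gamma (a + b + 1) / (Real.Gamma (a + 1) * Real.Gamma (b + 1))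

theorem two_mul_cos_half_nonneg (hθ : θ ∈ Set.Icc (-π) π) : 0 ≤ 2 * Real.cos (θ / 2) :=
  mul_nonneg zero_le_two
    (Real.cos_nonneg_of_mem_Icc ⟨by linarith [hθ.1], by linarith [hθ.2]⟩)

theorem two_mul_cos_half_pos (hθ : θ ∈ Set.Ioo (-π) π) : 0 < 2 * Real.cos (θ / 2) :=
  mul_pos two_pos (Real.cos_pos_of_mem_Ioo ⟨by linarith [hθ.1], by linarith [hθ.2]⟩)

theorem continuous_fhWeight (hab : 0 ≤ a + b) : Continuous (fhWeight a b) :=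
  .mul (by fun_prop) (Complex.continuous_ofReal.comp
    (Continuous.rpow_const (by fun_prop) fun _ => Or.inr hab))

theorem fhWeight_neg (a b θ : ℝ) : fhWeight a b (-θ) = fhWeight b a θ := by
  rw [fhWeight, fhWeight, neg_div, Real.cos_neg, add_comm, mul_neg, ← neg_mul, ← neg_div, neg_sub]

theorem fhWeight_sub_add (a b t θ : ℝ) :
    fhWeight (a - t) (b + t) θ = fhWeight a b θ * Complex.exp (-(t * θ : ℝ) * Complex.I) := by
  rw [fhWeight, fhWeight, sub_add_add_cancel, mul_right_comm, ← Complex.exp_add]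
  push_cast
  ring_nf

theorem fhWeight_add_natCast (hab : 0 ≤ a + b) (hθ : θ ∈ Set.Icc (-π) π) (m : ℕ) :
    fhWeight (a + m) (b + m) θ = ((2 * Real.cos (θ / 2)) ^ 2) ^ m • fhWeight a b θ := by
  rw [fhWeight, fhWeight, show a + m + (b + m) = a + b + (2 * m : ℕ) by push_cast; ring,
    Real.rpow_add_of_nonneg (two_mul_cos_half_nonneg hθ) hab (Nat.cast_nonneg _),
    Real.rpow_natCast, add_sub_add_right_eq_sub, ← pow_mul, Complex.real_smul,
    Complex.ofReal_mul ((2 * Real.cos (θ / 2)) ^ (a + b))]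
  ring

theorem hasDerivAt_fhWeight (hθ : θ ∈ Set.Ioo (-π) π) : HasDerivAt (fhWeight a (b + 1))
    (Complex.I * ((a + b + 1) * fhWeight a b θ - (b + 1) * fhWeight a (b + 1) θ)) θ := by
  have hpos := two_mul_cos_half_pos hθ
  have hphase := ((hasDerivAt_id θ).const_mul ((a - (b + 1)) / 2)).ofReal_comp.mul_const
    Complex.I |>.cexp
  have hmodulus := ((hasDerivAt_id θ).div_const 2).cos.const_mul 2 |>.rpow_const
    (p := a + (b + 1)) (Or.inl hpos.ne') |>.ofReal_comp
  refine (hphase.mul hmodulus).congr_deriv ?_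
  have hsplit : fhWeight a b θ = Complex.exp (((a - (b + 1)) / 2 * θ : ℝ) * Complex.I) *
      (Real.cos (θ / 2) + Real.sin (θ / 2) * Complex.I) *
      (((2 * Real.cos (θ / 2)) ^ (a + b) : ℝ) : ℂ) := by
    rw [Complex.ofReal_cos, Complex.ofReal_sin, ← Complex.exp_mul_I, ← Complex.exp_add, fhWeight]
    push_cast
    ring_nf
  simp only [id_eq]
  rw [hsplit, fhWeight, ← add_assoc, add_sub_cancel_right, Real.rpow_add_one hpos.ne']
  push_cast
  linear_combination (-(a + b + 1) * Complex.exp ((a - (b + 1)) / 2 * θ * Complex.I) *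
    Complex.sin (θ / 2) * (((2 * Real.cos (θ / 2)) ^ (a + b) : ℝ) : ℂ)) * Complex.I_sq

theorem fhIntegral_comm (a b : ℝ) : fhIntegral a b = fhIntegral b a := by
  rw [fhIntegral, ← neg_neg π, ← intervalIntegral.integral_comp_neg, neg_neg]
  simp only [fhWeight_neg, fhIntegral]

theorem fhIntegral_add_one_right (hab : 0 ≤ a + b) :
    (b + 1) * fhIntegral a (b + 1) = (a + b + 1) * fhIntegral a b := by
  have hcont := continuous_fhWeight hab
  have hcont' : Continuous (fhWeight a (b + 1)) := continuous_fhWeight (by linarith)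
  have hboundary : ∀ θ, Real.cos (θ / 2) = 0 → fhWeight a (b + 1) θ = 0 := fun θ hθ => by
    rw [fhWeight, hθ, mul_zero, Real.zero_rpow (by linarith), Complex.ofReal_zero, mul_zero]
  have hftc := intervalIntegral.integral_eq_sub_of_hasDerivAt_of_le (neg_le_self Real.pi_nonneg)
    hcont'.continuousOn (fun θ hθ => hasDerivAt_fhWeight hθ)
    (Continuous.intervalIntegrable (by fun_prop) _ _)
  rw [hboundary π Real.cos_pi_div_two,
    hboundary (-π) (by rw [neg_div, Real.cos_neg, Real.cos_pi_div_two]), sub_zero,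
    intervalIntegral.integral_const_mul, intervalIntegral.integral_sub
      ((hcont.const_mul _).intervalIntegrable _ _) ((hcont'.const_mul _).intervalIntegrable _ _),
    intervalIntegral.integral_const_mul, intervalIntegral.integral_const_mul] at hftc
  exact (sub_eq_zero.1 ((mul_eq_zero.1 hftc).resolve_left Complex.I_ne_zero)).symm

theorem fhIntegral_add_one_add_one (hab : 0 ≤ a + b) :
    (a + 1) * (b + 1) * fhIntegral (a + 1) (b + 1) =
      (a + b + 1) * (a + b + 2) * fhIntegral a b := by
  have hleft := fhIntegral_add_one_right (a := b + 1) (b := a) (by linarith)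
  rw [fhIntegral_comm, fhIntegral_comm (b + 1)] at hleft
  have hright := fhIntegral_add_one_right hab
  push_cast at hleft
  linear_combination (b + 1 : ℂ) * hleft + (a + b + 2 : ℂ) * hright

theorem gammaBinom_add_one_add_one (hab : 0 ≤ a + b) :
    (a + 1) * (b + 1) * gammaBinom (a + 1) (b + 1) =
      (a + b + 1) * (a + b + 2) * gammaBinom a b := by
  rw [gammaBinom, gammaBinom, show a + 1 + (b + 1) + 1 = a + b + 1 + 1 + 1 by ring,
    Real.Gamma_add_one (by linarith), Real.Gamma_add_one (by linarith), div_eq_mul_inv,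
    div_eq_mul_inv, mul_inv, mul_inv, inv_Gamma_eq_self_mul_inv_Gamma_add_one (a + 1),
    inv_Gamma_eq_self_mul_inv_Gamma_add_one (b + 1)]
  ring

theorem gammaBinom_pos (ha : -1 < a) (hb : -1 < b) (hab : -1 < a + b) : 0 < gammaBinom a b :=
  div_pos (Real.Gamma_pos_of_pos (by linarith))
    (mul_pos (Real.Gamma_pos_of_pos (by linarith)) (Real.Gamma_pos_of_pos (by linarith)))

theorem gammaBinom_natCast_pos (m : ℕ) : 0 < gammaBinom m m := by
  have hm : -1 < (m : ℝ) := neg_one_lt_zero.trans_le m.cast_nonneg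
  exact gammaBinom_pos hm hm (neg_one_lt_zero.trans_le (by positivity))

theorem fhIntegral_mul_gammaBinom_add_natCast (hab : 0 ≤ a + b) (m : ℕ) :
    fhIntegral a b * gammaBinom (a + m) (b + m) = gammaBinom a b * fhIntegral (a + m) (b + m) := by
  induction m generalizing a b with
  | zero => simp [mul_comm]
  | succ m ih =>
    have hne : ((a + b + 1) * (a + b + 2) : ℂ) ≠ 0 := by
      have : (a + b + 1) * (a + b + 2) ≠ 0 := by positivity
      exact_mod_cast this
    have hih := ih (a := a + 1) (b := b + 1) (by linarith)
    have hintegral := fhIntegral_add_one_add_one hab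
    have hgamma := congrArg (fun x : ℝ => (x : ℂ)) (gammaBinom_add_one_add_one hab)
    push_cast at hgamma
    rw [Nat.cast_succ, add_comm (m : ℝ), ← add_assoc, ← add_assoc]
    refine mul_left_cancel₀ hne ?_
    linear_combination ((a : ℂ) + 1) * (b + 1) * hih -
      (gammaBinom (a + 1 + m) (b + 1 + m) : ℂ) * hintegral +
      fhIntegral (a + 1 + m) (b + 1 + m) * hgamma

theorem fhIntegral_natCast (m : ℕ) : fhIntegral m m = 2 * π * gammaBinom m m := by
  have hzero : fhIntegral 0 0 = 2 * π := by
    simp only [fhIntegral, fhWeight, sub_self, zero_div, zero_mul, Complex.ofReal_zero,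
      Complex.exp_zero, add_zero, Real.rpow_zero, Complex.ofReal_one, mul_one,
      intervalIntegral.integral_const, sub_neg_eq_add, Complex.real_smul, Complex.ofReal_add]
    ring
  have hgamma : gammaBinom 0 0 = 1 := by simp [gammaBinom]
  simpa only [hzero, hgamma, zero_add, Complex.ofReal_one, one_mul] using
    (fhIntegral_mul_gammaBinom_add_natCast (a := 0) (b := 0) (zero_add _).ge m).symm

theorem Gamma_add_natCast {x : ℝ} (hx : 0 < x) (m : ℕ) :
    Real.Gamma (x + m) = (∏ j ∈ Finset.range m, (x + j)) * Real.Gamma x := by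
  induction m with
  | zero => simp
  | succ m ih =>
    rw [Finset.prod_range_succ, Nat.cast_succ, ← add_assoc, Real.Gamma_add_one (by positivity), ih]
    ring

theorem tendsto_rpow_mul_factorial_div_Gamma {x : ℝ} (hx : 0 < x) :
    Tendsto (fun m : ℕ => (m : ℝ) ^ x * m.factorial / Real.Gamma (x + m + 1)) atTop (𝓝 1) := by
  have hGamma := (Real.Gamma_pos_of_pos hx).ne'
  have hlim := (Real.GammaSeq_tendsto_Gamma x).div_const (Real.Gamma x)
  rw [div_self hGamma] at hlim
  refine hlim.congr fun m => ?_
  rw [Real.GammaSeq, add_assoc, ← Nat.cast_succ, Gamma_add_natCast hx, div_div]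

theorem tendsto_gammaBinom_ratio (ha : 0 < a) (hb : 0 < b) :
    Tendsto (fun m : ℕ => gammaBinom (a + m) (b + m) / gammaBinom m m) atTop
      (𝓝 (2 ^ (a + b))) := by
  have hlim := (((tendsto_rpow_mul_factorial_div_Gamma ha).mul
    (tendsto_rpow_mul_factorial_div_Gamma hb)).div
    ((tendsto_rpow_mul_factorial_div_Gamma (add_pos ha hb)).comp
      (tendsto_id.const_mul_atTop' two_pos)) one_ne_zero).const_mul ((2 : ℝ) ^ (a + b))
  rw [one_mul, div_one, mul_one] at hlim
  refine hlim.congr' ?_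
  filter_upwards [eventually_gt_atTop 0] with m hm
  have hm : (0 : ℝ) < m := Nat.cast_pos.2 hm
  have hGamma : ∀ {x : ℝ}, 0 < x → ∀ n : ℕ, Real.Gamma (x + n + 1) ≠ 0 := fun hx n =>
    (Real.Gamma_pos_of_pos (by positivity)).ne'
  have := hGamma ha m
  have := hGamma hb m
  have := hGamma (add_pos ha hb) (2 * m)
  have := (Real.rpow_pos_of_pos hm a).ne'
  have := (Real.rpow_pos_of_pos hm b).ne'
  have := (Real.rpow_pos_of_pos two_pos (a + b)).ne'
  have hcast : ((2 * m : ℕ) : ℝ) = 2 * m := by push_cast; rfl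
  simp only [Pi.div_apply, Function.comp_apply, id_eq, gammaBinom]
  rw [← two_mul (m : ℝ), add_add_add_comm, ← two_mul (m : ℝ), ← hcast,
    Real.Gamma_nat_eq_factorial, Real.Gamma_nat_eq_factorial, hcast,
    Real.mul_rpow zero_le_two hm.le, Real.rpow_add hm, ← hcast]
  field_simp

theorem fhIntegral_add_natCast (hab : 0 ≤ a + b) (m : ℕ) : fhIntegral (a + m) (b + m) =
    ∫ θ in Set.Icc (-π) π, ((2 * Real.cos (θ / 2)) ^ 2) ^ m • fhWeight a b θ := by
  rw [fhIntegral, intervalIntegral.integral_of_le (neg_le_self Real.pi_nonneg),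
    ← integral_Icc_eq_integral_Ioc]
  exact setIntegral_congr_fun measurableSet_Icc fun θ hθ => fhWeight_add_natCast hab hθ m

/-- Laplace's method: the kernel `(2 cos (θ/2))^{2m}` concentrates at `θ = 0`. -/
theorem tendsto_fhIntegral_ratio (hab : 0 ≤ a + b) :
    Tendsto (fun m : ℕ => fhIntegral (a + m) (b + m) / fhIntegral m m) atTop
      (𝓝 ((2 ^ (a + b) : ℝ) : ℂ)) := by
  have hmax : ∀ θ ∈ Set.Icc (-π) π, θ ≠ 0 →
      (2 * Real.cos (θ / 2)) ^ 2 < (2 * Real.cos (0 / 2)) ^ 2 := fun θ hθ hne => by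
    have hle := two_mul_cos_half_nonneg hθ
    have hlt : Real.cos (θ / 2) < 1 := (Real.cos_le_one _).lt_of_ne fun hcos => hne <| by
      have hpi := Real.pi_pos
      have := (Real.cos_eq_one_iff_of_lt_of_lt (by linarith [hθ.1]) (by linarith [hθ.2])).1 hcos
      linarith
    rw [zero_div, Real.cos_zero]
    exact pow_lt_pow_left₀ (by linarith) hle two_ne_zero
  have hinterior : (0 : ℝ) ∈ closure (interior (Set.Icc (-π) π)) := by
    rw [interior_Icc]
    exact subset_closure ⟨neg_lt_zero.2 Real.pi_pos, Real.pi_pos⟩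
  have hlim := tendsto_setIntegral_pow_smul_of_unique_maximum_of_isCompact_of_continuousOn
    (μ := volume) isCompact_Icc (by fun_prop) hmax (fun θ _ => sq_nonneg _) (by simp) hinterior
    (continuous_fhWeight hab).continuousOn
  have hzero : fhWeight a b 0 = ((2 ^ (a + b) : ℝ) : ℂ) := by simp [fhWeight]
  rw [hzero] at hlim
  refine hlim.congr fun m => ?_
  have hdenom := fhIntegral_add_natCast (a := 0) (b := 0) (zero_add _).ge m
  rw [zero_add] at hdenom
  rw [fhIntegral_add_natCast hab, hdenom, Complex.real_smul, div_eq_inv_mul, Complex.ofReal_inv,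
    ← integral_complex_ofReal]
  simp [fhWeight]

theorem fhIntegral_eq_of_pos (ha : 0 < a) (hb : 0 < b) :
    fhIntegral a b = 2 * π * gammaBinom a b := by
  have hab := (add_pos ha hb).le
  have hpow : ((2 ^ (a + b) : ℝ) : ℂ) ≠ 0 :=
    Complex.ofReal_ne_zero.2 (Real.rpow_pos_of_pos two_pos _).ne'
  have hgamma := ((Complex.continuous_ofReal.tendsto _).comp
    (tendsto_gammaBinom_ratio ha hb)).const_mul (fhIntegral a b)
  have hintegral := (tendsto_fhIntegral_ratio hab).const_mul (2 * π * gammaBinom a b : ℂ)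
  refine mul_right_cancel₀ hpow (tendsto_nhds_unique (hgamma.congr fun m => ?_) hintegral)
  have hne : (gammaBinom m m : ℂ) ≠ 0 := Complex.ofReal_ne_zero.2 (gammaBinom_natCast_pos m).ne'
  rw [Function.comp_apply, Complex.ofReal_div, mul_div_assoc',
    fhIntegral_mul_gammaBinom_add_natCast hab, fhIntegral_natCast]
  field_simp

/-- Shifting both parameters by a large integer reduces to positive parameters. -/
theorem fhIntegral_eq (hab : 0 ≤ a + b) : fhIntegral a b = 2 * π * gammaBinom a b := by
  obtain ⟨m, hm⟩ := exists_nat_gt (max (-a) (-b))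
  obtain ⟨ha, hb⟩ : 0 < a + m ∧ 0 < b + m := by
    rw [max_lt_iff] at hm
    exact ⟨by linarith, by linarith⟩
  have hne : (gammaBinom (a + m) (b + m) : ℂ) ≠ 0 := Complex.ofReal_ne_zero.2
    (gammaBinom_pos (by linarith) (by linarith) (by linarith)).ne'
  refine mul_right_cancel₀ hne ?_
  rw [fhIntegral_mul_gammaBinom_add_natCast hab, fhIntegral_eq_of_pos ha hb]
  ring

theorem fhIntegral_eq_fhCoeff (hab : 0 ≤ a + b) (n : ℤ) :
    fhIntegral (a - n) (b + n) = 2 * π * fhCoeff a b n := by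
  rw [fhIntegral_eq (by rwa [sub_add_add_cancel]), gammaBinom, sub_add_add_cancel, fhCoeff]

end FisherHartwigIntegral

/-! ### The Andréief identity and the Morris integral -/

section Andreief

open MeasureTheory

variable {ι : Type*} [Fintype ι] [DecidableEq ι]

theorem det_mul_det_eq_sum_sum {R : Type*} [CommRing R] (A B : Matrix ι ι R) :
    A.det * B.det = ∑ σ : Equiv.Perm ι, ∑ τ : Equiv.Perm ι,
      (Equiv.Perm.sign σ : R) * (Equiv.Perm.sign τ : R) * ∏ i, (A i (σ i) * B i (τ i)) := by
  rw [← A.det_transpose, ← B.det_transpose, Matrix.det_apply', Matrix.det_apply',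
    Finset.sum_mul_sum]
  refine Finset.sum_congr rfl fun σ _ => Finset.sum_congr rfl fun τ _ => ?_
  rw [Finset.prod_mul_distrib, mul_mul_mul_comm]
  rfl

theorem sum_sign_mul_sign_mul_prod {R : Type*} [CommRing R] (M : Matrix ι ι R)
    (σ : Equiv.Perm ι) :
    ∑ τ : Equiv.Perm ι, (Equiv.Perm.sign σ : R) * (Equiv.Perm.sign τ : R) * ∏ i, M (σ i) (τ i) =
      M.det := by
  have hpermute : M.det = (Equiv.Perm.sign σ : R) * (M.submatrix σ id).det := by
    rw [Matrix.det_permute, ← mul_assoc, ← Int.cast_mul, Int.units_coe_mul_self, Int.cast_one,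
      one_mul]
  rw [hpermute, ← Matrix.det_transpose, Matrix.det_apply', Finset.mul_sum]
  exact Finset.sum_congr rfl fun τ _ => mul_assoc ..

theorem integral_det_mul_det {α 𝕜 : Type*} [MeasurableSpace α] [RCLike 𝕜] (ν : Measure α)
    [SigmaFinite ν] (f g : ι → α → 𝕜) (hfg : ∀ i j, Integrable (fun t => f i t * g j t) ν) :
    ∫ θ, Matrix.det (Matrix.of fun i j => f j (θ i)) * Matrix.det (Matrix.of fun i j => g j (θ i))
        ∂(Measure.pi fun _ : ι => ν) =
      (Fintype.card ι).factorial * Matrix.det (Matrix.of fun i j => ∫ t, f i t * g j t ∂ν) := by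
  have hintegrable : ∀ σ τ : Equiv.Perm ι, Integrable (fun θ : ι → α =>
      (Equiv.Perm.sign σ : 𝕜) * (Equiv.Perm.sign τ : 𝕜) *
        ∏ i, (f (σ i) (θ i) * g (τ i) (θ i))) (Measure.pi fun _ : ι => ν) := fun σ τ =>
    (Integrable.fintype_prod (f := fun i t => f (σ i) t * g (τ i) t)
      fun i => hfg (σ i) (τ i)).const_mul _
  simp only [det_mul_det_eq_sum_sum, Matrix.of_apply]
  rw [integral_finsetSum _ fun σ _ => integrable_finsetSum _ fun τ _ => hintegrable σ τ]
  have hsum : ∀ σ : Equiv.Perm ι, ∫ θ, ∑ τ : Equiv.Perm ι,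
      (Equiv.Perm.sign σ : 𝕜) * (Equiv.Perm.sign τ : 𝕜) * ∏ i, (f (σ i) (θ i) * g (τ i) (θ i))
        ∂(Measure.pi fun _ : ι => ν) =
      Matrix.det (Matrix.of fun i j => ∫ t, f i t * g j t ∂ν) := fun σ => by
    rw [integral_finsetSum _ fun τ _ => hintegrable σ τ, ← sum_sign_mul_sign_mul_prod _ σ]
    refine Finset.sum_congr rfl fun τ _ => ?_
    rw [integral_const_mul,
      integral_fintype_prod_eq_prod (fun i t => f (σ i) t * g (τ i) t)]
    rfl
  rw [Finset.sum_congr rfl fun σ _ => hsum σ, Finset.sum_const, Finset.card_univ,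
    Fintype.card_perm, nsmul_eq_mul]

end Andreief

section MorrisIntegral

open MeasureTheory

variable {a b : ℝ} {N : ℕ} {la mu : YoungDiagram}

theorem one_add_exp_mul_I (θ : ℝ) :
    1 + Complex.exp (θ * Complex.I) =
      Complex.exp ((θ / 2 : ℝ) * Complex.I) * ((2 * Real.cos (θ / 2) : ℝ) : ℂ) := by
  rw [Complex.ofReal_mul, Complex.ofReal_cos, Complex.ofReal_ofNat, Complex.two_cos, mul_add,
    ← Complex.exp_add, ← Complex.exp_add, neg_mul, add_neg_cancel, Complex.exp_zero, add_comm,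
    ← add_mul, ← Complex.ofReal_add, add_halves]

theorem exp_mul_norm_one_add_exp_rpow {θ : ℝ} (hθ : θ ∈ Set.Ioo (-π) π) :
    Complex.exp ((θ : ℂ) * Complex.I * ((a - b : ℝ) : ℂ) / 2) *
        ((‖1 + Complex.exp ((θ : ℂ) * Complex.I)‖ ^ (a + b) : ℝ) : ℂ) = fhWeight a b θ := by
  rw [one_add_exp_mul_I, norm_mul, Complex.norm_exp_ofReal_mul_I, one_mul, Complex.norm_real,
    Real.norm_of_nonneg (two_mul_cos_half_pos hθ).le, fhWeight]
  push_cast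
  ring_nf

theorem pureFH_exp (γ δ : ℕ) (θ : ℝ) : pureFH γ δ (Circle.exp θ) = fhWeight γ δ θ := by
  rw [pureFH, Circle.coe_exp, ← Complex.exp_neg, ← neg_mul, ← Complex.ofReal_neg,
    one_add_exp_mul_I, one_add_exp_mul_I, fhWeight, ← Nat.cast_add, Real.rpow_natCast, neg_div,
    Real.cos_neg, mul_pow, mul_pow, ← Complex.exp_nat_mul, ← Complex.exp_nat_mul, pow_add,
    Complex.ofReal_mul ((2 * Real.cos (θ / 2)) ^ γ), Complex.ofReal_pow, Complex.ofReal_pow,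
    mul_mul_mul_comm, ← Complex.exp_add]
  push_cast
  ring_nf

theorem circleCoeff_pureFH (γ δ : ℕ) (n : ℤ) : circleCoeff (pureFH γ δ) n = fhCoeff γ δ n := by
  have hintegrand : ∀ x : ℝ, @fourier 1 (-n) x •
      pureFH γ δ (AddCircle.toCircle (x : AddCircle (1 : ℝ))) =
        fhWeight (γ - n) (δ + n) (2 * π * x) := fun x => by
    rw [AddCircle.toCircle_apply_mk, div_one, pureFH_exp, fourier_coe_apply, smul_eq_mul,
      mul_comm, fhWeight_sub_add]
    push_cast
    ring_nf
  rw [circleCoeff, fourierCoeff_eq_intervalIntegral _ _ (-(1 / 2))]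
  simp only [hintegrand]
  rw [intervalIntegral.integral_comp_mul_left (fhWeight (γ - n) (δ + n)) Real.two_pi_pos.ne',
    show 2 * π * -(1 / 2) = -π by ring, show 2 * π * (-(1 / 2) + 1) = π by ring, ← fhIntegral,
    fhIntegral_eq_fhCoeff (by positivity), div_one, one_smul, Complex.real_smul]
  push_cast
  field_simp

theorem fhWeight_mul_exp_pow_mul_exp_pow (a b : ℝ) (m n : ℕ) (θ : ℝ) :
    fhWeight a b θ * Complex.exp (θ * Complex.I) ^ m * Complex.exp (-θ * Complex.I) ^ n =
      fhWeight (a - ((n : ℤ) - m : ℤ)) (b + ((n : ℤ) - m : ℤ)) θ := by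
  rw [fhWeight_sub_add, ← Complex.exp_nat_mul, ← Complex.exp_nat_mul, mul_assoc,
    ← Complex.exp_add]
  push_cast
  ring_nf

theorem setIntegral_fhWeight (hab : 0 ≤ a + b) (n : ℤ) :
    ∫ θ in Set.Ioo (-π) π, fhWeight (a - n) (b + n) θ = 2 * π * fhCoeff a b n := by
  rw [← fhIntegral_eq_fhCoeff hab, fhIntegral,
    intervalIntegral.integral_of_le (neg_le_self Real.pi_nonneg), integral_Ioc_eq_integral_Ioo]

theorem prod_norm_exp_sub_exp_sq (θ : Fin N → ℝ) :
    ∏ j, ∏ k ∈ Finset.Ioi j, ((‖Complex.exp ((θ j : ℂ) * Complex.I) -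
        Complex.exp ((θ k : ℂ) * Complex.I)‖ ^ 2 : ℝ) : ℂ) =
      alternant ⊥ (fun j => Complex.exp ((θ j : ℂ) * Complex.I)) *
        alternant ⊥ (fun j => Complex.exp (-(θ j : ℂ) * Complex.I)) := by
  have hconj : ∀ t : ℝ, (starRingEnd ℂ) (Complex.exp ((t : ℂ) * Complex.I)) =
      Complex.exp (-(t : ℂ) * Complex.I) := fun t => by
    rw [← Complex.exp_conj, map_mul, Complex.conj_ofReal, Complex.conj_I, mul_neg, neg_mul]
  rw [alternant_bot_eq_sign_mul_det_vandermonde, alternant_bot_eq_sign_mul_det_vandermonde,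
    mul_mul_mul_comm, ← Int.cast_mul, Int.units_coe_mul_self, Int.cast_one, one_mul,
    Matrix.det_vandermonde, Matrix.det_vandermonde]
  simp only [← Finset.prod_mul_distrib]
  refine Finset.prod_congr rfl fun j _ => Finset.prod_congr rfl fun k _ => ?_
  rw [Complex.ofReal_pow, ← Complex.mul_conj', map_sub, hconj, hconj]
  ring

theorem morris_integrand_schur (hla : la.colLen 0 ≤ N) (hmu : mu.colLen 0 ≤ N) {θ : Fin N → ℝ}
    (hθ : ∀ j, θ j ∈ Set.Ioo (-π) π) :
    MvPolynomial.eval (fun j => Complex.exp ((θ j : ℂ) * Complex.I)) (schur ℂ la N) *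
      MvPolynomial.eval (fun j => Complex.exp (-(θ j : ℂ) * Complex.I)) (schur ℂ mu N) *
      (∏ j, Complex.exp ((θ j : ℂ) * Complex.I * ((a - b : ℝ) : ℂ) / 2) *
        ((‖1 + Complex.exp ((θ j : ℂ) * Complex.I)‖ ^ (a + b) : ℝ) : ℂ)) *
      ∏ j, ∏ k ∈ Finset.Ioi j,
        ((‖Complex.exp ((θ j : ℂ) * Complex.I) - Complex.exp ((θ k : ℂ) * Complex.I)‖ ^ 2 : ℝ) :
          ℂ) =
      Matrix.det (Matrix.of fun i j : Fin N =>
        fhWeight a b (θ i) * Complex.exp (θ i * Complex.I) ^ alternantExponent la j) *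
      Matrix.det (Matrix.of fun i j : Fin N =>
        Complex.exp (-θ i * Complex.I) ^ alternantExponent mu j) := by
  have hcolumn := Matrix.det_mul_column (fun j => fhWeight a b (θ j)) (Matrix.of fun i j : Fin N =>
    Complex.exp (θ i * Complex.I) ^ alternantExponent la j)
  simp only [Matrix.of_apply] at hcolumn
  rw [hcolumn, Finset.prod_congr rfl fun j _ => exp_mul_norm_one_add_exp_rpow (hθ j),
    prod_norm_exp_sub_exp_sq, schur, schur, eval_skewSchur, eval_skewSchur, ← alternant,
    ← alternant, ← skewSchurEval_bot_mul_alternant_bot _ hla,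
    ← skewSchurEval_bot_mul_alternant_bot _ hmu]
  ring

theorem morrisIntegral_schur (hab : 0 ≤ a + b) (hla : la.colLen 0 ≤ N) (hmu : mu.colLen 0 ≤ N) :
    morrisIntegral N a b (schur ℂ la N) (schur ℂ mu N) =
      Matrix.det (Matrix.of fun j k : Fin N =>
        (fhCoeff a b ((j : ℤ) - la.rowLen j - (k : ℤ) + mu.rowLen k) : ℂ)) := by
  have hrestrict : volume.restrict (Set.univ.pi fun _ : Fin N => Set.Ioo (-π) π) =
      Measure.pi fun _ : Fin N => (volume : Measure ℝ).restrict (Set.Ioo (-π) π) := by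
    rw [volume_pi, Measure.restrict_pi_pi]
  have hentry : ∀ j k : Fin N, ∫ t in Set.Ioo (-π) π,
      fhWeight a b t * Complex.exp (t * Complex.I) ^ alternantExponent la j *
        Complex.exp (-t * Complex.I) ^ alternantExponent mu k =
      2 * π * fhCoeff a b ((j : ℤ) - la.rowLen j - (k : ℤ) + mu.rowLen k) := fun j k => by
    simp only [fhWeight_mul_exp_pow_mul_exp_pow]
    rw [setIntegral_fhWeight hab, intCast_alternantExponent, intCast_alternantExponent,
      add_sub_add_right_eq_sub, betaNumber, betaNumber]
    ring_nf
  rw [morrisIntegral, setIntegral_congr_fun (MeasurableSet.univ_pi fun _ => measurableSet_Ioo)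
    fun θ hθ => morris_integrand_schur hla hmu fun j => hθ j (Set.mem_univ j), hrestrict,
    integral_det_mul_det _ (fun j t => fhWeight a b t *
      Complex.exp (t * Complex.I) ^ alternantExponent la j)
      fun k t => Complex.exp (-t * Complex.I) ^ alternantExponent mu k]
  · have hsmul : (Matrix.of fun j k : Fin N => 2 * π *
        (fhCoeff a b ((j : ℤ) - la.rowLen j - (k : ℤ) + mu.rowLen k) : ℂ)) = (2 * π : ℂ) •
        Matrix.of fun j k : Fin N =>
          (fhCoeff a b ((j : ℤ) - la.rowLen j - (k : ℤ) + mu.rowLen k) : ℂ) := rfl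
    have hfactorial : (N.factorial : ℂ) ≠ 0 := Nat.cast_ne_zero.2 N.factorial_ne_zero
    simp only [hentry]
    rw [hsmul, Matrix.det_smul, Fintype.card_fin]
    field_simp
  · intro j k
    simp only [fhWeight_mul_exp_pow_mul_exp_pow]
    exact (continuous_fhWeight (by rwa [sub_add_add_cancel])).integrableOn_Icc.mono_set
      Set.Ioo_subset_Icc_self

end MorrisIntegral

/-! ### Specialization at ones -/

section Specialization

variable {N : ℕ}

theorem fhCoeff_natCast (g d : ℕ) (n : ℤ) :
    fhCoeff g d n = elemSymm (fun _ : Fin (g + d) => (1 : ℝ)) (d + n) := by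
  rw [elemSymm_one, fhCoeff]
  split_ifs with h
  · obtain ⟨m, hm⟩ := Int.eq_ofNat_of_zero_le h
    have hcast : (d : ℝ) + n = m := by exact_mod_cast hm
    have hsub : (g : ℝ) - n = (g + d : ℕ) - m := by
      rw [← hcast, Nat.cast_add]
      ring
    have hGamma : Real.Gamma ((g + d : ℕ) + 1) ≠ 0 :=
      (Real.Gamma_pos_of_pos (Nat.cast_add_one_pos _)).ne'
    rw [hm, Int.toNat_natCast, ← Ring.choose_natCast, choose_eq_Gamma_div hGamma, hcast, hsub,
      Real.Gamma_nat_eq_factorial m, mul_comm (m.factorial : ℝ), Nat.cast_add]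
  · obtain ⟨m, hm⟩ : ∃ m : ℕ, (d : ℤ) + n + 1 = -m := ⟨(-(d + n + 1)).toNat, by lia⟩
    have hcast : (d : ℝ) + n + 1 = -m := by exact_mod_cast hm
    rw [hcast, Real.Gamma_neg_nat_eq_zero, mul_zero, div_zero]

theorem rowLen_rectPartition (a b i : ℕ) :
    (rectPartition a b).rowLen i = if i < b then a else 0 :=
  eq_of_forall_lt_iff fun j => by
    rw [← YoungDiagram.mem_iff_lt_rowLen, mem_rectPartition]
    split_ifs with h <;> simp [h]

theorem colLen_rectPartition_le (a b : ℕ) : (rectPartition a b).colLen 0 ≤ b :=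
  colLen_zero_le_iff.2 fun i hi => by rw [rowLen_rectPartition, if_neg hi.not_gt]

theorem transpose_rectPartition (a b : ℕ) : (rectPartition a b).transpose = rectPartition b a :=
  SetLike.ext fun ⟨i, j⟩ => by
    rw [YoungDiagram.mem_transpose, Prod.swap_prod_mk, mem_rectPartition, mem_rectPartition,
      and_comm]

theorem transpose_bot : (⊥ : YoungDiagram).transpose = ⊥ :=
  SetLike.ext fun c => by simp only [YoungDiagram.mem_transpose, YoungDiagram.notMem_bot]

theorem colLen_addPartition_le {al be : YoungDiagram} (hal : al.colLen 0 ≤ N)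
    (hbe : be.colLen 0 ≤ N) : (addPartition al be).colLen 0 ≤ N :=
  colLen_zero_le_iff.2 fun i hi => by
    rw [rowLen_addPartition, colLen_zero_le_iff.1 hal i hi, colLen_zero_le_iff.1 hbe i hi]

theorem mem_rectWithRow {d j : ℕ} (hj : j ≤ N) {a b : ℕ} :
    (a, b) ∈ rectWithRow N d j hj ↔ a < d ∧ b < N ∨ a = d ∧ b < j := by
  rw [rectWithRow, YoungDiagram.mem_ofRowLens]
  simp only [List.length_append, List.length_replicate, List.length_singleton]
  rcases lt_trichotomy a d with h | rfl | h
  · simp [List.getElem_append_left, h, h.ne, h.trans_le (Nat.le_succ d)]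
  · simp
  · simp [h.not_gt, h.ne', show ¬ a < d + 1 by lia]

theorem rectWithRow_eq_transpose {d j : ℕ} (hj : j ≤ N) :
    rectWithRow N d j hj = (addPartition (rectPartition d N) (rectPartition 1 j)).transpose := by
  refine SetLike.ext fun ⟨a, b⟩ => ?_
  rw [mem_rectWithRow, YoungDiagram.mem_transpose, Prod.swap_prod_mk, mem_addPartition,
    rowLen_rectPartition, rowLen_rectPartition]
  split_ifs <;> lia

theorem evalOnes_skewSchur_addPartition {R : Type*} [CommRing R] (d n : ℕ) {la mu : YoungDiagram}
    (hla : la.colLen 0 ≤ N) (hmu : mu.colLen 0 ≤ N) :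
    evalOnes (skewSchur R (addPartition (rectPartition d N) mu).transpose la.transpose n) =
      Matrix.det (Matrix.of fun j k : Fin N => elemSymm (fun _ : Fin n => (1 : R))
        (d + ((j : ℤ) - la.rowLen j - (k : ℤ) + mu.rowLen k))) := by
  rw [evalOnes, eval_skewSchur, skewSchurEval_transpose _
    (colLen_addPartition_le (colLen_rectPartition_le d N) hmu) hla, ← Matrix.det_transpose]
  congr 1
  ext j k
  rw [Matrix.transpose_apply, Matrix.of_apply, Matrix.of_apply, betaNumber, betaNumber,
    rowLen_addPartition, rowLen_rectPartition, if_pos k.2]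
  push_cast
  ring_nf

theorem schur_column (R : Type*) [CommRing R] (N k : ℕ) :
    schur R (rectPartition 1 k) N = MvPolynomial.esymm (Fin N) R k := by
  rw [schur, skewSchur_eq_skewSchurEval_X, ← transpose_rectPartition, ← transpose_bot,
    skewSchurEval_transpose _ (colLen_rectPartition_le k 1)
      (colLen_zero_le_iff.2 fun i _ => rowLen_bot i), Matrix.det_fin_one, Matrix.of_apply,
    betaNumber, betaNumber, rowLen_rectPartition, rowLen_bot, if_pos (0 : Fin 1).is_lt,
    sub_sub_sub_cancel_right, Nat.cast_zero, sub_zero, elemSymm_natCast]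
  rfl

theorem toeplitzMinor_pureFH (γ δ : ℕ) {la mu : YoungDiagram} (hla : la.colLen 0 ≤ N)
    (hmu : mu.colLen 0 ≤ N) : toeplitzMinor N la mu (pureFH γ δ) =
      evalOnes (skewSchur ℂ (addPartition (rectPartition δ N) mu).transpose la.transpose
        (γ + δ)) := by
  have hentry : ∀ n : ℤ, circleCoeff (pureFH γ δ) n =
      elemSymm (fun _ : Fin (γ + δ) => (1 : ℂ)) (δ + n) := fun n => by
    rw [circleCoeff_pureFH, fhCoeff_natCast, elemSymm_one, elemSymm_one]
    split_ifs <;> simp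
  rw [evalOnes_skewSchur_addPartition δ _ hla hmu, toeplitzMinor]
  simp only [hentry]

theorem morrisIntegral_schur_eq_toeplitzMinor (γ δ : ℕ) {la mu : YoungDiagram}
    (hla : la.colLen 0 ≤ N) (hmu : mu.colLen 0 ≤ N) :
    morrisIntegral N γ δ (schur ℂ la N) (schur ℂ mu N) =
      toeplitzMinor N la mu (pureFH γ δ) := by
  rw [morrisIntegral_schur (by positivity) hla hmu, toeplitzMinor]
  simp only [circleCoeff_pureFH]

theorem intCast_succAbove {k : ℕ} (hk : k < N + 1) (a : Fin N) :
    ((Fin.succAbove ⟨k, hk⟩ a : ℕ) : ℤ) = (a : ℤ) - (rectPartition 1 k).rowLen a + 1 := by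
  rw [rowLen_rectPartition]
  split_ifs with h
  · rw [Fin.succAbove_of_castSucc_lt ⟨k, hk⟩ a h, Fin.val_castSucc, Nat.cast_one, sub_add_cancel]
  · rw [Fin.succAbove_of_le_castSucc ⟨k, hk⟩ a (not_lt.1 h), Fin.val_succ, Nat.cast_succ,
      Nat.cast_zero, sub_zero]

/-- The Toeplitz minor of a pair of columns deletes one row and one column of the Toeplitz matrix of
size `N + 1`. -/
theorem det_fhCoeff_columns {g d : ℝ} (hg : -1 < g) (hd : -1 < d) (hgd : -1 < g + d) {j k : ℕ}
    (hj : j ≤ N) (hk : k ≤ N) :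
    Matrix.det (Matrix.of fun a b : Fin N => fhCoeff g d ((a : ℤ) - (rectPartition 1 k).rowLen a -
      (b : ℤ) + (rectPartition 1 j).rowLen b)) = explicitValue N j k (g + d) d := by
  have hminor := det_fhMatrix_submatrix_succAbove hg hd hgd
    (⟨j, Nat.lt_succ_of_le hj⟩ : Fin (N + 1)) ⟨k, Nat.lt_succ_of_le hk⟩
  rw [explicitValue_eq hg hd hgd, ← hminor]
  congr 1
  ext a b
  rw [Matrix.submatrix_apply, fhMatrix, Matrix.of_apply, Matrix.of_apply, intCast_succAbove,
    intCast_succAbove, add_sub_add_right_eq_sub, ← sub_add]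

theorem evalOnes_skewSchur_rectWithRow {d j k M : ℕ} (hj : j ≤ N) (hk : k ≤ N) (hd : d ≤ M) :
    evalOnes (skewSchur ℝ (rectWithRow N d j hj) (rectPartition k 1) M) =
      explicitValue N j k M d := by
  obtain ⟨g, rfl⟩ := Nat.exists_eq_add_of_le' hd
  have hneg : ∀ n : ℕ, -1 < (n : ℝ) := fun n => neg_one_lt_zero.trans_le n.cast_nonneg
  have hminor := det_fhCoeff_columns (hneg g) (hneg d) (by exact_mod_cast hneg (g + d)) hj hk
  rw [rectWithRow_eq_transpose, ← transpose_rectPartition 1 k, evalOnes_skewSchur_addPartition d _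
    ((colLen_rectPartition_le 1 k).trans hk) ((colLen_rectPartition_le 1 j).trans hj),
    Nat.cast_add, ← hminor]
  simp only [fhCoeff_natCast]

theorem morrisIntegral_esymm {γ δ : ℝ} (hγ : -1 < γ) (hδ : -1 < δ) (hγδ : 0 ≤ γ + δ) {j k : ℕ}
    (hj : j ≤ N) (hk : k ≤ N) :
    morrisIntegral N γ δ (MvPolynomial.esymm (Fin N) ℂ k) (MvPolynomial.esymm (Fin N) ℂ j) =
      (explicitValue N j k (γ + δ) δ : ℂ) := by
  rw [← schur_column, ← schur_column, morrisIntegral_schur hγδ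
    ((colLen_rectPartition_le 1 k).trans hk) ((colLen_rectPartition_le 1 j).trans hj),
    ← det_fhCoeff_columns hγ hδ (by linarith) hj hk]
  exact (Complex.ofRealHom.map_det _).symm

end Specialization

theorem mainTheorem5_general (N : ℕ) :
    (∀ (γ δ : ℕ) (la mu : YoungDiagram), la.colLen 0 ≤ N → mu.colLen 0 ≤ N →
      toeplitzMinor N la mu (pureFH γ δ) =
          evalOnes (skewSchur ℂ (addPartition (rectPartition δ N) mu).transpose la.transpose
            (γ + δ)) ∧
        morrisIntegral N γ δ (schur ℂ la N) (schur ℂ mu N) =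
          toeplitzMinor N la mu (pureFH γ δ)) ∧
    (∀ k : ℕ, schur ℂ (rectPartition 1 k) N = MvPolynomial.esymm (Fin N) ℂ k) ∧
    (∀ (j k : ℕ) (hj : j ≤ N), k ≤ N → ∀ (d M : ℕ), d ≤ M →
      evalOnes (skewSchur ℝ (rectWithRow N d j hj) (rectPartition k 1) M) =
        explicitValue N j k M d) ∧
    (∀ (j k : ℕ), j ≤ N → k ≤ N → ∀ (γ δ : ℝ), -1 < γ → -1 < δ → 0 ≤ γ + δ →
      morrisIntegral N γ δ (MvPolynomial.esymm (Fin N) ℂ k) (MvPolynomial.esymm (Fin N) ℂ j) =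
        (explicitValue N j k (γ + δ) δ : ℂ)) :=
  ⟨fun γ δ _ _ hla hmu => ⟨toeplitzMinor_pureFH γ δ hla hmu,
      morrisIntegral_schur_eq_toeplitzMinor γ δ hla hmu⟩,
    schur_column ℂ N,
    fun _ _ hj hk _ _ hd => evalOnes_skewSchur_rectWithRow hj hk hd,
    fun _ _ hj hk _ _ hγ hδ hγδ => morrisIntegral_esymm hγ hδ hγδ hj hk⟩

theorem mainTheorem5 (N : ℕ) (hN : 1 ≤ N) :
    -- the Toeplitz minor is a specialized skew Schur polynomial and a Morris integral
    (∀ (γ δ : ℕ), 1 ≤ γ → 1 ≤ δ → ∀ (la mu : YoungDiagram), la.colLen 0 ≤ N → mu.colLen 0 ≤ N →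
      toeplitzMinor N la mu (pureFH γ δ) =
          evalOnes (skewSchur ℂ (addPartition (rectPartition δ N) mu).transpose la.transpose
            (γ + δ)) ∧
        morrisIntegral N γ δ (schur ℂ la N) (schur ℂ mu N) =
          toeplitzMinor N la mu (pureFH γ δ)) ∧
    -- the Schur polynomial of a column is elementary symmetric
    (∀ k : ℕ, k ≤ N → schur ℂ (rectPartition 1 k) N = MvPolynomial.esymm (Fin N) ℂ k) ∧
    -- the explicit evaluation of the skew Schur polynomial
    (∀ (j k : ℕ) (hj : j ≤ N), k ≤ N → ∀ (d M : ℕ), (d < M ∨ (d ≤ M ∧ j = 0)) →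
      evalOnes (skewSchur ℝ (rectWithRow N d j hj) (rectPartition k 1) M) =
        explicitValue N j k M d) ∧
    -- the explicit evaluation of the Morris integral, for all positive real parameters
    (∀ (j k : ℕ), j ≤ N → k ≤ N → ∀ (γ δ : ℝ), 0 < γ → 0 < δ →
      morrisIntegral N γ δ (MvPolynomial.esymm (Fin N) ℂ k) (MvPolynomial.esymm (Fin N) ℂ j) =
        (explicitValue N j k (γ + δ) δ : ℂ)) := by
  obtain ⟨hminor, hcolumn, hexplicit, hmorris⟩ := mainTheorem5_general N
  exact ⟨fun γ δ _ _ => hminor γ δ, fun k _ => hcolumn k,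
    fun j k hj hk d M hd => hexplicit j k hj hk d M (hd.elim le_of_lt And.left),
    fun j k hj hk γ δ hγ hδ => hmorris j k hj hk γ δ (by linarith) (by linarith) (by linarith)⟩
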